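/- **Corollary (Scaling from the omni-directional reception case).** Let $\Phi=\{x_i\}_{i\in\mathbb N}$ be a homogeneous Poisson point process on $\mathbb R^2$ with intensity $\lambda>0$, let $\alpha>2$, and let the channel gains $h_i$ be i.i.d. copies of a random variable $h>0$ with $E[h]<\infty$, independent of $\Phi$. A receiver is located at $0$ (or, more generally, at any fixed point, which then replaces $0$ below), and node $i$ produces there the interference power $h_i\|x_i\|^{-\alpha}$. Let $0<\phi\le 2\pi$ and let $I_1\ge I_2\ge\cdots$ be the interference powers, in descending order, of those nodes $x_i$ whose angle in $[0,2\pi)$ with respect to the horizontal axis is at most $\phi$. Let $n\ge 1$ be an integer with $n+1>\alpha/2$, and let $\mathcal I(n)=\sum_{k=n+1}^{\infty} I_k$ be the partial accumulative interference under directional reception with angle $\phi$. For $R>0$ let $\mathcal I_{\Phi\setminus B_0(R)}=\sum_{x_i\in\Phi\setminus B_0(R)}h_i\|x_i\|^{-\alpha}$ be the omni-directional interference from the nodes outside the disc $B_0(R)$ of radius $R$ around $0$. Then, for every $R>0$, $$E\big[\mathcal I_{\Phi\setminus B_0(R)}\big]=2\pi\lambda\,E[h]\,\frac{R^{2-\alpha}}{\alpha-2},$$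 and $$E[\mathcal I(n)]=E\big[\mathcal I_{\Phi\setminus B_0(R)}\big]\quad\text{for}\quad R=\left(\frac{\phi\,E[h^{2/\alpha}]}{2}\right)^{\frac{\alpha}{2(2-\alpha)}}\left(\frac{(n)_{1-\alpha/2}}{\pi\,E[h]}\right)^{\frac1{2-\alpha}}\lambda^{-1/2},$$ where $(n)_{1-\alpha/2}=\Gamma(n+1-\alpha/2)/\Gamma(n)$; this $R$ is positive. -/

import Mathlib

open MeasureTheory ProbabilityTheory
open scoped ENNReal NNReal

noncomputable section

/-- The Euclidean plane, in which the nodes of the network live. -/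
abbrev Plane : Type := EuclideanSpace ℝ (Fin 2)

/-- The number of points of the family `(x i)` lying in `B`, as an extended natural number. -/
def pointCount (x : ℕ → Plane) (B : Set Plane) : ℕ∞ :=
  {i : ℕ | x i ∈ B}.encard

/-- The random points `X 0, X 1, …` (in an arbitrary measurable enumeration) form a homogeneous
Poisson point process on the plane with intensity `lam`: the number of points in a Borel set `B`
of finite area is Poisson distributed with mean `lam * area B`, and the numbers of points in
pairwise disjoint Borel sets are independent. -/
structure IsHomogeneousPoissonProcess {Ω : Type*} [MeasurableSpace Ω] (P : Measure Ω)
    (X : ℕ → Ω → Plane) (lam : ℝ) : Prop where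
  measurable : ∀ i, Measurable (X i)
  poisson : ∀ B : Set Plane, MeasurableSet B → volume B < ∞ → ∀ k : ℕ,
    P {ω | pointCount (fun i => X i ω) B = (k : ℕ∞)} =
      poissonMeasure (lam.toNNReal * (volume B).toNNReal) {k}
  indep : ∀ (m : ℕ) (B : Fin m → Set Plane), (∀ j, MeasurableSet (B j)) →
    Pairwise (fun j l => Disjoint (B j) (B l)) →
    iIndepFun (fun j ω => pointCount (fun i => X i ω) (B j)) P

/-- The channel gains `h i` are independent with common law `ν`, and the whole sequence of gains
is independent of the sequence of node positions. -/
structure IsChannelGain {Ω : Type*} [MeasurableSpace Ω] (P : Measure Ω)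
    (X : ℕ → Ω → Plane) (h : ℕ → Ω → ℝ) (ν : Measure ℝ) : Prop where
  measurable : ∀ i, Measurable (h i)
  law : ∀ i, P.map (h i) = ν
  indep : iIndepFun h P
  indep_nodes : IndepFun (fun ω i => X i ω) (fun ω i => h i ω) P

/-- The angle of the vector `v` with respect to the horizontal axis, in `[0, 2π)`
(equal to `0` for `v = 0`). -/
def polarAngle (v : Plane) : ℝ :=
  toIcoMod Real.two_pi_pos 0 (Complex.arg ⟨v 0, v 1⟩)

/-- The interference power `g * ‖rx - y‖ ^ (-α)` received at `rx` from a node at `y` with channel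
gain `g`. -/
def interferencePower (α : ℝ) (rx y : Plane) (g : ℝ) : ℝ≥0∞ :=
  ENNReal.ofReal (g * ‖rx - y‖ ^ (-α))

/-- The indices of the nodes received at `rx` with reception angle `φ`. -/
def directionalNodes (φ : ℝ) (rx : Plane) (x : ℕ → Plane) : Set ℕ :=
  {i | polarAngle (x i - rx) ≤ φ}

/-- The `k`-th largest value (`k = 1, 2, …`, counted with multiplicity) of the family `a` on the
index set `S`: the largest level that is reached by at least `k` indices of `S`. -/
def kthLargest (S : Set ℕ) (a : ℕ → ℝ≥0∞) (k : ℕ) : ℝ≥0∞ :=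
  sSup {t : ℝ≥0∞ | (k : ℕ∞) ≤ {i ∈ S | t ≤ a i}.encard}

/-- The `k`-th dominant interference power under directional reception with angle `φ`, for nodes
`x i` with channel gains `g i`. -/
def dominantInterference (α φ : ℝ) (rx : Plane) (x : ℕ → Plane) (g : ℕ → ℝ) (k : ℕ) : ℝ≥0∞ :=
  kthLargest (directionalNodes φ rx x) (fun i => interferencePower α rx (x i) (g i)) k

/-- The partial accumulative interference under directional reception: the sum of the `k`-th
dominant interference powers over all `k ≥ n + 1`. -/
def partialInterference (α φ : ℝ) (rx : Plane) (n : ℕ) (x : ℕ → Plane) (g : ℕ → ℝ) : ℝ≥0∞ :=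
  ∑' k : ℕ, dominantInterference α φ rx x g (n + 1 + k)

open Classical in
/-- The omni-directional accumulative interference at `rx` from all the nodes outside the disc of
radius `R` around `rx`. -/
def outsideInterference (α : ℝ) (rx : Plane) (R : ℝ) (x : ℕ → Plane) (g : ℕ → ℝ) : ℝ≥0∞ :=
  ∑' i : ℕ, if x i ∈ Metric.ball rx R then 0 else interferencePower α rx (x i) (g i)

/-- The Pochhammer symbol `(n)_s = Γ(n + s) / Γ(n)` with a real index `s`. -/
def realPochhammer (n : ℕ) (s : ℝ) : ℝ :=
  Real.Gamma (n + s) / Real.Gamma n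

/-- The moment `E[h ^ s]` of a channel gain with law `ν`. -/
def gainMoment (ν : Measure ℝ) (s : ℝ) : ℝ :=
  ∫ t, t ^ s ∂ν

/-- The radius
`R = (φ E[h^(2/α)] / 2)^(α / (2(2-α))) ((n)_{1-α/2} / (π E[h]))^(1/(2-α)) lam^(-1/2)`. -/
def equivalentRadius (α φ lam : ℝ) (ν : Measure ℝ) (n : ℕ) : ℝ :=
  (φ * gainMoment ν (2 / α) / 2) ^ (α / (2 * (2 - α))) *
    (realPochhammer n (1 - α / 2) / (Real.pi * ∫ t, t ∂ν)) ^ (1 / (2 - α)) *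
    lam ^ (-(1 / 2) : ℝ)

end

/-! The mean outside the disc is Campbell's formula for the marked process (`lintegral_tsum_marked`)
followed by a radial integral in the plane.

For the partial interference, let `N t` be the number of nodes in the sector received with power at
least `t`. By the marking theorem (`markedCount_poisson`) it is Poisson. Its mean is `c * t ^ (-(2 /
α))` with `c = lam * φ * E[h ^ (2 / α)] / 2` (`lintegral_measure_strongNodes`), so the gain law
enters only through one moment. Since `I_k` is the length of the set of levels `t > 0` with `N t ≥
k` (`kthLargest_eq_volume`), `E[I_k]` is the integral of the Poisson tail `P (N t ≥ k)` over `t`.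
Summing over `k ≥ n + 1` and applying Tonelli twice leaves a Gamma integral
(`tsum_lintegral_poissonTail`), with value `c ^ (α / 2) * Γ (n + 1 - α / 2) / ((α / 2 - 1) * Γ n)`.
The radius solves the equation between the two means.

The marking theorem is derived from the counts of the unmarked process alone. Independent Poisson
counts on level sets give the Laplace functional for simple functions, and monotone limits extend it
(`lintegral_iInf_prod`). Integrating out the gains then yields the generating function of a marked
count, which determines its law (`eq_of_tsum_pow_mul_eq`). -/

/-! ### Counting indices, and infinite products as infima of partial products. -/

section Counting

variable {Y : Type*} [MeasurableSpace Y] {Q : ℕ → Y → Prop}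

/-- There are at least `k` such indices iff all members of some `k`-element finite set qualify, and
`ℕ` has only countably many finite subsets. -/
lemma measurableSet_le_encard (hQ : ∀ i, MeasurableSet {y | Q i y}) (k : ℕ) :
    MeasurableSet {y | (k : ℕ∞) ≤ {i | Q i y}.encard} := by
  have : {y | (k : ℕ∞) ≤ {i | Q i y}.encard} =
      ⋃ s ∈ {s : Finset ℕ | s.card = k}, ⋂ i ∈ s, {y | Q i y} := by
    ext y
    simp only [Set.mem_ofPred_eq, Set.mem_iUnion, Set.mem_iInter, exists_prop]
    constructor
    · intro h
      obtain ⟨t, ht, htk⟩ := Set.exists_subset_encard_eq h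
      have hfin : t.Finite := Set.finite_of_encard_eq_coe htk
      refine ⟨hfin.toFinset, ?_, fun i hi => ht (by simpa using hi)⟩
      rw [hfin.encard_eq_coe_toFinset_card] at htk
      exact_mod_cast htk
    · rintro ⟨s, rfl, hs⟩
      rw [← Set.encard_coe_eq_coe_finsetCard]
      exact Set.encard_le_encard fun i hi => hs i (by simpa using hi)
  rw [this]
  exact MeasurableSet.biUnion (Set.to_countable _) fun s _ =>
    Finset.measurableSet_biInter s fun i _ => hQ i

lemma measurable_encard_setOf (hQ : ∀ i, MeasurableSet {y | Q i y}) :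
    Measurable fun y => {i | Q i y}.encard := by
  refine measurable_to_countable' fun a => ?_
  induction a using ENat.recTopCoe with
  | top =>
    have : (fun y => {i | Q i y}.encard) ⁻¹' {⊤} =
        ⋂ k : ℕ, {y | (k : ℕ∞) ≤ {i | Q i y}.encard} := by
      ext y
      simp only [Set.mem_preimage, Set.mem_singleton_iff, Set.mem_iInter, Set.mem_ofPred_eq]
      exact ⟨fun h k => h ▸ le_top, fun h => ENat.eq_top_iff_forall_ge.2 h⟩
    rw [this]
    exact MeasurableSet.iInter fun k => measurableSet_le_encard hQ k
  | coe k =>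
    have : (fun y => {i | Q i y}.encard) ⁻¹' {(k : ℕ∞)} =
        {y | (k : ℕ∞) ≤ {i | Q i y}.encard} \ {y | ((k + 1 : ℕ) : ℕ∞) ≤ {i | Q i y}.encard} := by
      ext y
      simp only [Set.mem_preimage, Set.mem_singleton_iff, Set.mem_sdiff, Set.mem_ofPred_eq, not_le,
        Nat.cast_add, Nat.cast_one, ENat.lt_add_one_iff (ENat.natCast_ne_top k)]
      exact ⟨fun h => ⟨h.ge, h.le⟩, fun h => le_antisymm h.2 h.1⟩
    rw [this]
    exact (measurableSet_le_encard hQ k).diff (measurableSet_le_encard hQ (k + 1))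

open Classical in
lemma toENNReal_encard (S : Set ℕ) :
    (S.encard : ℝ≥0∞) = ∑' i, if i ∈ S then 1 else 0 := by
  rw [← ENNReal.tsum_set_one, tsum_subtype S fun _ => (1 : ℝ≥0∞)]
  rfl

/-- Infinite products of factors at most 1 are treated as infima of their partial products, so no
convergence question arises. This lemma is what lets finite products pass through such infima. -/
lemma ENNReal.prod_iInf_of_antitone {ι : Type*} (s : Finset ι) {f : ι → ℕ → ℝ≥0∞}
    (hf : ∀ i, Antitone (f i)) (hfin : ∀ i m, f i m ≠ ∞) :
    ∏ i ∈ s, ⨅ m, f i m = ⨅ m, ∏ i ∈ s, f i m := by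
  refine tendsto_nhds_unique ?_
    (tendsto_atTop_iInf fun a b hab => Finset.prod_le_prod' fun i _ => hf i hab)
  refine ENNReal.tendsto_finsetProd_of_ne_top s
    (fun i _ => tendsto_atTop_iInf (hf i)) fun i _ => ?_
  exact ne_top_of_le_ne_top (hfin i 0) (iInf_le _ 0)

open Classical in
lemma prod_ite_eq_pow_card (S : Set ℕ) (z : ℝ≥0∞) (s : Finset ℕ) :
    ∏ i ∈ s, (if i ∈ S then z else 1) = z ^ (s.filter (· ∈ S)).card := by
  rw [Finset.prod_ite]; simp

open Classical in
lemma iInf_prod_ite_eq_pow {S : Set ℕ} {z : ℝ≥0∞} (hz : z ≤ 1) {k : ℕ}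
    (hS : S.encard = k) :
    ⨅ m, ∏ i ∈ Finset.range m, (if i ∈ S then z else 1) = z ^ k := by
  have hfin : S.Finite := Set.finite_of_encard_eq_coe hS
  have hk : hfin.toFinset.card = k := by
    rw [hfin.encard_eq_coe_toFinset_card] at hS
    exact_mod_cast hS
  refine le_antisymm ?_ (le_iInf fun m => ?_)
  · obtain ⟨m, hm⟩ := hfin.toFinset.exists_nat_subset_range
    refine iInf_le_of_le m ?_
    rw [prod_ite_eq_pow_card, ← hk]
    refine le_of_eq ?_
    congr 2
    ext i
    simp only [Finset.mem_filter, Set.Finite.mem_toFinset, and_iff_right_iff_imp]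
    exact fun h => hm (by simpa using h)
  · rw [prod_ite_eq_pow_card, ← hk]
    refine pow_le_pow_right_of_le_one' hz (Finset.card_le_card fun i => ?_)
    simp

end Counting

/-! ### The Poisson law: generating function, mean, and counts valued in `ℕ∞`. -/

section Poisson

lemma tsum_poissonMeasure_mul_pow (r : ℝ≥0) {z : ℝ} (hz : 0 ≤ z) :
    ∑' k, ENNReal.ofReal z ^ k * poissonMeasure r {k} =
      ENNReal.ofReal (Real.exp (-(r * (1 - z)))) := by
  have hs : HasSum (fun k : ℕ => z ^ k * (Real.exp (-r) * r ^ k / k.factorial))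
      (Real.exp (-(r * (1 - z)))) := by
    convert! (NormedSpace.expSeries_div_hasSum_exp (r * z : ℝ)).mul_left (Real.exp (-r)) using 1
    · ext k; rw [mul_pow]; ring
    · rw [← Real.exp_eq_exp_ℝ, ← Real.exp_add]; ring_nf
  rw [← hs.tsum_eq, ENNReal.ofReal_tsum_of_nonneg (fun k => by positivity) hs.summable]
  refine tsum_congr fun k => ?_
  rw [poissonMeasure_singleton, ENNReal.ofReal_mul (by positivity), ENNReal.ofReal_pow hz]

lemma tsum_natCast_mul_poissonMeasure (r : ℝ≥0) :
    ∑' k : ℕ, (k : ℝ≥0∞) * poissonMeasure r {k} = r := by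
  rw [_root_.tsum_eq_zero_add' ENNReal.summable]
  have : ∀ k : ℕ, ((k + 1 : ℕ) : ℝ≥0∞) * poissonMeasure r {k + 1} = r * poissonMeasure r {k} := by
    intro k
    rw [poissonMeasure_singleton, poissonMeasure_singleton, ← ENNReal.ofReal_natCast,
      ← ENNReal.ofReal_coe_nnreal, ← ENNReal.ofReal_mul (by positivity),
      ← ENNReal.ofReal_mul (by positivity), Nat.factorial_succ]
    congr 1
    push_cast
    field_simp
    ring
  simp_rw [this, ENNReal.tsum_mul_left]
  have h1 : ∑' k, poissonMeasure r {k} = 1 := by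
    simpa using tsum_poissonMeasure_mul_pow r zero_le_one
  simp [h1]

variable {Ω : Type*} [MeasurableSpace Ω] {P : Measure Ω} [IsProbabilityMeasure P]
  {N : Ω → ℕ∞} {r : ℝ≥0}

/-- The hypothesis gives only the masses of finite values. They already add up to 1, so nothing is
left for `⊤`. -/
lemma map_eq_map_natCast_poissonMeasure (hN : Measurable N)
    (h : ∀ k : ℕ, P {ω | N ω = k} = poissonMeasure r {k}) :
    P.map N = (poissonMeasure r).map ((↑) : ℕ → ℕ∞) := by
  have := Measure.isProbabilityMeasure_map hN.aemeasurable (μ := P)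
  have hc : Measurable ((↑) : ℕ → ℕ∞) := .of_discrete
  have := Measure.isProbabilityMeasure_map hc.aemeasurable (μ := poissonMeasure r)
  have hcoe : ∀ k : ℕ, P.map N {(k : ℕ∞)} = (poissonMeasure r).map ((↑) : ℕ → ℕ∞) {(k : ℕ∞)} := by
    intro k
    rw [Measure.map_apply hN (measurableSet_singleton _),
      Measure.map_apply hc (measurableSet_singleton _)]
    have : ((↑) : ℕ → ℕ∞) ⁻¹' {(k : ℕ∞)} = {k} := by ext j; simp
    rw [this, ← h k]
    rfl
  have htop : ({⊤} : Set ℕ∞) = (⋃ k : ℕ, {(k : ℕ∞)})ᶜ := by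
    ext a
    induction a using ENat.recTopCoe <;> simp
  refine Measure.ext_iff_singleton.2 fun a => ?_
  induction a using ENat.recTopCoe with
  | coe k => exact hcoe k
  | top =>
    rw [htop, prob_compl_eq_one_sub .of_discrete, prob_compl_eq_one_sub .of_discrete]
    congr 1
    have hd : Pairwise (Function.onFun Disjoint fun k : ℕ => ({(k : ℕ∞)} : Set ℕ∞)) := by
      intro i j hij
      simpa [Function.onFun] using hij
    rw [measure_iUnion hd fun _ => .of_discrete, measure_iUnion hd fun _ => .of_discrete]
    exact tsum_congr hcoe

lemma lintegral_comp_of_poisson (hN : Measurable N)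
    (h : ∀ k : ℕ, P {ω | N ω = k} = poissonMeasure r {k}) (F : ℕ∞ → ℝ≥0∞) :
    ∫⁻ ω, F (N ω) ∂P = ∑' k : ℕ, F k * poissonMeasure r {k} := by
  rw [← lintegral_map (f := F) .of_discrete hN, map_eq_map_natCast_poissonMeasure hN h,
    lintegral_map .of_discrete .of_discrete, lintegral_countable']

lemma ae_ne_top_of_poisson (hN : Measurable N)
    (h : ∀ k : ℕ, P {ω | N ω = k} = poissonMeasure r {k}) : ∀ᵐ ω ∂P, N ω ≠ ⊤ := by
  have := lintegral_comp_of_poisson hN h (fun a => if a = ⊤ then 1 else 0)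
  simp only [ENat.natCast_ne_top, if_false, zero_mul, tsum_zero] at this
  have hm : Measurable fun ω => if N ω = ⊤ then (1 : ℝ≥0∞) else 0 :=
    (Measurable.of_discrete (f := fun a : ℕ∞ => if a = ⊤ then (1 : ℝ≥0∞) else 0)).comp hN
  rw [lintegral_eq_zero_iff hm] at this
  filter_upwards [this] with ω hω htop
  simp [htop] at hω

end Poisson

/-! ### Campbell's formula and the Laplace functional. -/

section PoissonProcess

variable {Ω : Type*} [MeasurableSpace Ω] {P : Measure Ω} [IsProbabilityMeasure P]
  {X : ℕ → Ω → Plane} {h : ℕ → Ω → ℝ} {ν : Measure ℝ} [IsProbabilityMeasure ν] {lam : ℝ}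

namespace IsHomogeneousPoissonProcess

omit [IsProbabilityMeasure P] in
lemma measurable_pointCount (hX : IsHomogeneousPoissonProcess P X lam) {B : Set Plane}
    (hB : MeasurableSet B) : Measurable fun ω => pointCount (fun i => X i ω) B :=
  measurable_encard_setOf fun i => hX.measurable i hB

lemma lintegral_pointCount (hX : IsHomogeneousPoissonProcess P X lam) {B : Set Plane}
    (hB : MeasurableSet B) (hfin : volume B < ∞) :
    ∫⁻ ω, (pointCount (fun i => X i ω) B : ℝ≥0∞) ∂P = lam.toNNReal * volume B := by
  rw [lintegral_comp_of_poisson (hX.measurable_pointCount hB) (hX.poisson B hB hfin)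
    (fun a => (a : ℝ≥0∞))]
  simp only [ENat.toENNReal_coe]
  rw [tsum_natCast_mul_poissonMeasure, ENNReal.coe_mul, ENNReal.coe_toNNReal hfin.ne]

/-- The intensity measure of a homogeneous Poisson process. -/
lemma sum_map_eq (hX : IsHomogeneousPoissonProcess P X lam) :
    (Measure.sum fun i => P.map (X i)) = lam.toNNReal • (volume : Measure Plane) := by
  have hfinite : ∀ B : Set Plane, MeasurableSet B → volume B < ∞ →
      (Measure.sum fun i => P.map (X i)) B = lam.toNNReal * volume B := by
    classical
    intro B hB hfin
    rw [← hX.lintegral_pointCount hB hfin, Measure.sum_apply _ hB]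
    simp_rw [pointCount, toENNReal_encard]
    rw [lintegral_tsum (f := fun i ω => if i ∈ {i | X i ω ∈ B} then (1 : ℝ≥0∞) else 0) fun i =>
      (Measurable.ite (hX.measurable i hB) measurable_const measurable_const).aemeasurable]
    refine tsum_congr fun i => ?_
    rw [Measure.map_apply (hX.measurable i) hB, ← lintegral_indicator_one (hX.measurable i hB)]
    rfl
  refine Measure.ext fun B hB => ?_
  -- The mean count is known only for sets of finite area, so `B` is exhausted by such sets.
  have hU : B = ⋃ k, B ∩ spanningSets volume k := by
    rw [← Set.inter_iUnion, iUnion_spanningSets, Set.inter_univ]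
  have hm : Monotone fun k => B ∩ spanningSets (volume : Measure Plane) k := fun a b hab =>
    Set.inter_subset_inter_right _ (monotone_spanningSets _ hab)
  rw [hU, hm.measure_iUnion, hm.measure_iUnion]
  refine iSup_congr fun k => ?_
  rw [hfinite _ (hB.inter (measurableSet_spanningSets _ _))
    ((measure_mono Set.inter_subset_right).trans_lt (measure_spanningSets_lt_top _ _))]
  rfl

/-- Campbell's formula. -/
lemma lintegral_tsum_comp (hX : IsHomogeneousPoissonProcess P X lam) {f : Plane → ℝ≥0∞}
    (hf : Measurable f) :
    ∫⁻ ω, ∑' i, f (X i ω) ∂P = lam.toNNReal * ∫⁻ x, f x := by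
  rw [lintegral_tsum (f := fun i ω => f (X i ω)) fun i => (hf.comp (hX.measurable i)).aemeasurable]
  have : ∀ i, ∫⁻ ω, f (X i ω) ∂P = ∫⁻ x, f x ∂(P.map (X i)) := fun i =>
    (lintegral_map hf (hX.measurable i)).symm
  simp_rw [this]
  rw [← lintegral_sum_measure, hX.sum_map_eq, lintegral_smul_measure]
  rfl

end IsHomogeneousPoissonProcess

/-- The joint law of positions and gains is a product measure. With the positions frozen, the gains
are independent with law `ν` and are integrated out factor by factor. -/
lemma IsChannelGain.lintegral_prod_comp (hh : IsChannelGain P X h ν)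
    (hX : ∀ i, Measurable (X i)) {F : Plane → ℝ → ℝ≥0∞} (hF : Measurable (Function.uncurry F))
    (s : Finset ℕ) :
    ∫⁻ ω, ∏ i ∈ s, F (X i ω) (h i ω) ∂P = ∫⁻ ω, ∏ i ∈ s, ∫⁻ g, F (X i ω) g ∂ν ∂P := by
  have hXm : Measurable fun ω i => X i ω := measurable_pi_lambda _ hX
  have hhm : Measurable fun ω i => h i ω := measurable_pi_lambda _ hh.measurable
  have hFx : ∀ x, Measurable (F x) := fun x => hF.comp measurable_prodMk_left
  have hG : Measurable fun p : (ℕ → Plane) × (ℕ → ℝ) => ∏ i ∈ s, F (p.1 i) (p.2 i) :=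
    Finset.measurable_fun_prod s fun i _ =>
      Measurable.comp (g := Function.uncurry F) (f := fun p : (ℕ → Plane) × (ℕ → ℝ) => (p.1 i, p.2 i)) hF
      (((measurable_pi_apply i).comp measurable_fst).prodMk
        ((measurable_pi_apply i).comp measurable_snd))
  have hI : Measurable fun x => ∫⁻ g, F x g ∂ν := hF.lintegral_prod_right'
  have hH : Measurable fun x : ℕ → Plane => ∏ i ∈ s, ∫⁻ g, F (x i) g ∂ν :=
    Finset.measurable_fun_prod s fun i _ => hI.comp (measurable_pi_apply i)
  have := Measure.isProbabilityMeasure_map hhm.aemeasurable (μ := P)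
  calc ∫⁻ ω, ∏ i ∈ s, F (X i ω) (h i ω) ∂P
      = ∫⁻ p, ∏ i ∈ s, F (p.1 i) (p.2 i)
          ∂(P.map fun ω => ((fun i => X i ω), fun i => h i ω)) :=
        (lintegral_map hG (hXm.prodMk hhm)).symm
    _ = ∫⁻ x, ∫⁻ y, ∏ i ∈ s, F (x i) (y i) ∂(P.map fun ω i => h i ω)
          ∂(P.map fun ω i => X i ω) := by
        rw [hh.indep_nodes.map_prod_eq_prod_map_map hXm.aemeasurable hhm.aemeasurable,
          lintegral_prod _ hG.aemeasurable]
    _ = ∫⁻ x, ∏ i ∈ s, ∫⁻ g, F (x i) g ∂ν ∂(P.map fun ω i => X i ω) := by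
        refine lintegral_congr fun x => ?_
        rw [lintegral_map (f := fun y : ℕ → ℝ => ∏ i ∈ s, F (x i) (y i))
          (hG.comp measurable_prodMk_left) hhm,
          lintegral_prod_eq_prod_lintegral_of_indepFun s (fun i ω => F (x i) (h i ω))
            (hh.indep.comp (fun i => F (x i)) fun i => hFx _)
            fun i => (hFx _).comp (hh.measurable i)]
        refine Finset.prod_congr rfl fun i _ => ?_
        rw [← hh.law i, lintegral_map (hFx _) (hh.measurable i)]
    _ = ∫⁻ ω, ∏ i ∈ s, ∫⁻ g, F (X i ω) g ∂ν ∂P := lintegral_map hH hXm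

/-- Campbell's formula for the marked process. -/
lemma IsHomogeneousPoissonProcess.lintegral_tsum_marked
    (hX : IsHomogeneousPoissonProcess P X lam) (hh : IsChannelGain P X h ν)
    {F : Plane → ℝ → ℝ≥0∞} (hF : Measurable (Function.uncurry F)) :
    ∫⁻ ω, ∑' i, F (X i ω) (h i ω) ∂P = lam.toNNReal * ∫⁻ x, ∫⁻ g, F x g ∂ν := by
  have hI : Measurable fun x => ∫⁻ g, F x g ∂ν := hF.lintegral_prod_right'
  rw [← hX.lintegral_tsum_comp hI,
    lintegral_tsum (f := fun i ω => F (X i ω) (h i ω)) fun i =>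
      (hF.comp ((hX.measurable i).prodMk (hh.measurable i))).aemeasurable,
    lintegral_tsum (f := fun i ω => ∫⁻ g, F (X i ω) g ∂ν) fun i => (hI.comp (hX.measurable i)).aemeasurable]
  refine tsum_congr fun i => ?_
  -- A single node is the case of a product with one factor.
  simpa using hh.lintegral_prod_comp hX.measurable hF {i}

lemma antitone_prod_range {u : ℕ → ℝ≥0∞} (hu : ∀ i, u i ≤ 1) :
    Antitone fun m => ∏ i ∈ Finset.range m, u i := by
  refine antitone_nat_of_succ_le fun m => ?_
  rw [Finset.prod_range_succ]
  exact mul_le_of_le_one_right' (hu m)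

namespace IsHomogeneousPoissonProcess

open Classical in
lemma ae_iInf_prod_ite (hX : IsHomogeneousPoissonProcess P X lam) {B : Set Plane}
    (hB : MeasurableSet B) (hfin : volume B < ∞) {z : ℝ≥0∞} (hz : z ≤ 1) :
    ∀ᵐ ω ∂P, ⨅ m, ∏ i ∈ Finset.range m, (if X i ω ∈ B then z else 1) =
      z ^ (pointCount (fun i => X i ω) B).toNat := by
  filter_upwards [ae_ne_top_of_poisson (hX.measurable_pointCount hB) (hX.poisson B hB hfin)]
    with ω hω
  exact iInf_prod_ite_eq_pow (S := {i | X i ω ∈ B}) hz (ENat.natCast_toNat hω).symm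

lemma lintegral_pow_pointCount (hX : IsHomogeneousPoissonProcess P X lam) {B : Set Plane}
    (hB : MeasurableSet B) (hfin : volume B < ∞) {c : ℝ≥0∞} (hc : c ≤ 1) :
    ∫⁻ ω, (1 - c) ^ (pointCount (fun i => X i ω) B).toNat ∂P =
      ENNReal.ofReal (Real.exp (-(lam.toNNReal * (c * volume B).toReal))) := by
  rw [lintegral_comp_of_poisson (hX.measurable_pointCount hB) (hX.poisson B hB hfin)
    (fun a => (1 - c) ^ a.toNat)]
  have hctop : c ≠ ∞ := ne_top_of_le_ne_top ENNReal.one_ne_top hc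
  have h1 : 1 - c = ENNReal.ofReal (1 - c.toReal) := by
    rw [ENNReal.ofReal_sub _ ENNReal.toReal_nonneg, ENNReal.ofReal_one, ENNReal.ofReal_toReal hctop]
  have h2 : c.toReal ≤ 1 := ENNReal.toReal_le_of_le_ofReal zero_le_one (by simpa using hc)
  simp only [ENat.toNat_natCast]
  rw [h1, tsum_poissonMeasure_mul_pow _ (by linarith)]
  congr 3
  rw [ENNReal.toReal_mul]
  push_cast
  ring

/-- The Laplace functional at a simple function. -/
lemma lintegral_iInf_prod_simpleFunc (hX : IsHomogeneousPoissonProcess P X lam)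
    (q : SimpleFunc Plane ℝ≥0∞) (hq : ∀ x, q x ≤ 1) (hfin : ∫⁻ x, q x ≠ ∞) :
    ∫⁻ ω, ⨅ m, ∏ i ∈ Finset.range m, (1 - q (X i ω)) ∂P =
      ENNReal.ofReal (Real.exp (-(lam.toNNReal * (∫⁻ x, q x).toReal))) := by
  classical
  -- The level sets of `q` are indexed by `Fin` to match the form of the independence axiom.
  let e : Fin q.range.card ≃ q.range := q.range.equivFin.symm
  let c : Fin q.range.card → ℝ≥0∞ := fun j => (e j : ℝ≥0∞)
  let B : Fin q.range.card → Set Plane := fun j => q ⁻¹' {c j}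
  have hBm : ∀ j, MeasurableSet (B j) := fun j => q.measurableSet_fiber _
  have hc1 : ∀ j, c j ≤ 1 := by
    intro j
    obtain ⟨x, hx⟩ := SimpleFunc.mem_range.1 (e j).2
    exact (show q x = c j from hx) ▸ hq x
  have hcinj : ∀ i j, c i = c j → i = j := fun i j hij => e.injective (Subtype.ext hij)
  have hdisj : Pairwise fun j l => Disjoint (B j) (B l) := by
    intro j l hjl
    rw [Set.disjoint_left]
    intro x hx hx'
    exact hjl (hcinj _ _ ((show q x = c j from hx).symm.trans hx'))
  have hsum : ∫⁻ x, q x = ∑ j, c j * volume (B j) := by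
    rw [SimpleFunc.lintegral_eq_lintegral, SimpleFunc.lintegral,
      ← Finset.sum_coe_sort q.range fun y => y * volume (q ⁻¹' {y})]
    exact (e.sum_comp fun y : q.range => (y : ℝ≥0∞) * volume (q ⁻¹' {(y : ℝ≥0∞)})).symm
  have hterm : ∀ j, c j * volume (B j) ≠ ∞ := by
    intro j
    rw [hsum] at hfin
    exact (ENNReal.sum_ne_top.1 hfin) j (Finset.mem_univ j)
  have hvol : ∀ j, c j ≠ 0 → volume (B j) < ∞ := fun j hj =>
    lt_top_iff_ne_top.2 fun htop => hterm j (by rw [htop, ENNReal.mul_top hj])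
  -- The level set of the value 0 may have infinite area, and its count need not be Poisson. Its
  -- factors `1 - 0` are trivial, so `G` ignores that count.
  let G : Fin q.range.card → ℕ∞ → ℝ≥0∞ := fun j a => if c j = 0 then 1 else (1 - c j) ^ a.toNat
  have hG : ∀ᵐ ω ∂P, ∀ j,
      ⨅ m, ∏ i ∈ Finset.range m, (if X i ω ∈ B j then 1 - c j else 1) =
        G j (pointCount (fun i => X i ω) (B j)) := by
    rw [ae_all_iff]
    intro j
    by_cases hj : c j = 0
    · simp [G, hj]
    · filter_upwards [hX.ae_iInf_prod_ite (hBm j) (hvol j hj) (tsub_le_self : 1 - c j ≤ 1)]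
        with ω hω
      simp only [G, hj, if_false]
      exact hω
  -- Each `x` lies in exactly one level set, so one factor at most differs from 1.
  have hfac : ∀ x, 1 - q x = ∏ j, if x ∈ B j then 1 - c j else 1 := by
    intro x
    obtain ⟨j, hj⟩ : ∃ j, c j = q x :=
      ⟨e.symm ⟨q x, SimpleFunc.mem_range_self q x⟩, by simp [c]⟩
    rw [Finset.prod_eq_single j]
    · rw [if_pos (show x ∈ B j from hj.symm), hj]
    · intro l _ hl
      exact if_neg fun hx : x ∈ B l => hl (hcinj _ _ (hj.trans (show q x = c l from hx)).symm)
    · simp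
  calc ∫⁻ ω, ⨅ m, ∏ i ∈ Finset.range m, (1 - q (X i ω)) ∂P
      = ∫⁻ ω, ∏ j, G j (pointCount (fun i => X i ω) (B j)) ∂P := by
        refine lintegral_congr_ae ?_
        filter_upwards [hG] with ω hω
        simp_rw [hfac, ← hω]
        rw [ENNReal.prod_iInf_of_antitone]
        · exact iInf_congr fun m => Finset.prod_comm
        · exact fun j => antitone_prod_range fun i => by split_ifs <;> simp
        · refine fun j m => (ENNReal.prod_lt_top fun i _ => ?_).ne
          split_ifs
          · exact tsub_le_self.trans_lt ENNReal.one_lt_top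
          · exact ENNReal.one_lt_top
    _ = ∏ j, ∫⁻ ω, G j (pointCount (fun i => X i ω) (B j)) ∂P :=
        lintegral_prod_eq_prod_lintegral_of_indepFun _ _
          ((hX.indep _ B hBm hdisj).comp G fun _ => .of_discrete)
          fun j => (Measurable.of_discrete (f := G j)).comp (hX.measurable_pointCount (hBm j))
    _ = ∏ j, ENNReal.ofReal (Real.exp (-(lam.toNNReal * (c j * volume (B j)).toReal))) := by
        refine Finset.prod_congr rfl fun j _ => ?_
        by_cases hj : c j = 0
        · simp [G, hj]
        · simp only [G, hj, if_false]
          exact hX.lintegral_pow_pointCount (hBm j) (hvol j hj) (hc1 j)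
    _ = _ := by
        rw [← ENNReal.ofReal_prod_of_nonneg fun _ _ => (Real.exp_pos _).le, ← Real.exp_sum,
          hsum, ENNReal.toReal_sum fun j _ => hterm j, Finset.sum_neg_distrib, Finset.mul_sum]

/-- The Laplace functional of a homogeneous Poisson process, in multiplicative form. -/
lemma lintegral_iInf_prod (hX : IsHomogeneousPoissonProcess P X lam) {w : Plane → ℝ≥0∞}
    (hw : Measurable w) (hw1 : ∀ x, w x ≤ 1) (hfin : ∫⁻ x, (1 - w x) ≠ ∞) :
    ∫⁻ ω, ⨅ m, ∏ i ∈ Finset.range m, w (X i ω) ∂P =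
      ENNReal.ofReal (Real.exp (-(lam.toNNReal * (∫⁻ x, (1 - w x)).toReal))) := by
  have hqm : Measurable fun x => 1 - w x := measurable_const.sub hw
  -- Simple functions increase to `1 - w`, so `1 - q k` decreases to `w`. Both sides of the formula
  -- are then monotone limits in `k`.
  let q := SimpleFunc.eapprox fun x => 1 - w x
  have hqmono : Monotone q := SimpleFunc.monotone_eapprox _
  have hqsup : ∀ x, ⨆ k, q k x = 1 - w x := SimpleFunc.iSup_eapprox_apply hqm
  have hqle : ∀ k x, q k x ≤ 1 - w x := fun k x => hqsup x ▸ le_iSup (fun k => q k x) k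
  have hq1 : ∀ k x, q k x ≤ 1 := fun k x => (hqle k x).trans tsub_le_self
  have hqfin : ∀ k, ∫⁻ x, q k x ≠ ∞ := fun k =>
    ne_top_of_le_ne_top hfin (lintegral_mono (hqle k))
  have hwinf : ∀ x, w x = ⨅ k, (1 - q k x) := by
    intro x
    rw [← ENNReal.sub_iSup ENNReal.one_ne_top, hqsup,
      ENNReal.sub_sub_cancel ENNReal.one_ne_top (hw1 x)]
  have hlt : ∀ k x, 1 - q k x ≠ ∞ := fun k x =>
    ne_top_of_le_ne_top ENNReal.one_ne_top tsub_le_self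
  have hswap : ∀ ω, ⨅ m, ∏ i ∈ Finset.range m, w (X i ω) =
      ⨅ k, ⨅ m, ∏ i ∈ Finset.range m, (1 - q k (X i ω)) := by
    intro ω
    rw [iInf_comm]
    refine iInf_congr fun m => ?_
    simp_rw [hwinf]
    exact ENNReal.prod_iInf_of_antitone _
      (fun i a b hab => tsub_le_tsub_left (hqmono hab _) 1) fun i k => hlt k _
  simp_rw [hswap]
  have hmeas : ∀ k, Measurable fun ω => ⨅ m, ∏ i ∈ Finset.range m, (1 - q k (X i ω)) := fun k =>
    Measurable.iInf fun m => Finset.measurable_fun_prod _ fun i _ =>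
      measurable_const.sub ((q k).measurable.comp (hX.measurable i))
  have hanti : Antitone fun k ω => ⨅ m, ∏ i ∈ Finset.range m, (1 - q k (X i ω)) :=
    fun a b hab ω => iInf_mono fun m => Finset.prod_le_prod' fun i _ =>
      tsub_le_tsub_left (hqmono hab _) 1
  have hlap := fun k => hX.lintegral_iInf_prod_simpleFunc (q k) (hq1 k) (hqfin k)
  rw [lintegral_iInf hmeas hanti (by rw [hlap]; exact ENNReal.ofReal_ne_top)]
  simp_rw [hlap]
  have hint : ∫⁻ x, (1 - w x) = ⨆ k, ∫⁻ x, q k x := by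
    rw [← lintegral_iSup (fun k => (q k).measurable) fun a b hab => hqmono hab]
    simp_rw [hqsup]
  have hlim : Filter.Tendsto (fun k => ∫⁻ x, q k x) Filter.atTop (nhds (∫⁻ x, (1 - w x))) := by
    rw [hint]
    exact tendsto_atTop_iSup fun a b hab => lintegral_mono (hqmono hab)
  refine tendsto_nhds_unique (tendsto_atTop_iInf fun a b hab => ?_)
    (ENNReal.tendsto_ofReal ((Real.continuous_exp.tendsto _).comp
      (((ENNReal.tendsto_toReal hfin).comp hlim).const_mul _).neg))
  refine ENNReal.ofReal_le_ofReal (Real.exp_le_exp.2 (neg_le_neg ?_))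
  exact mul_le_mul_of_nonneg_left
    (ENNReal.toReal_mono (hqfin b) (lintegral_mono (hqmono hab))) (NNReal.coe_nonneg _)

end IsHomogeneousPoissonProcess

end PoissonProcess

/-! ### Generating functions determine their coefficients. -/

/-- Once the lower coefficients vanish, dividing by `z ^ K` expresses `d K` as minus the rest of the
series. That rest is at most `z / (1 - z)`, which tends to 0 as `z` decreases to 0. -/
lemma eq_zero_of_tsum_pow_mul_eq_zero {d : ℕ → ℝ} (hd : ∀ k, |d k| ≤ 1)
    (h : ∀ z ∈ Set.Ioo (0 : ℝ) 1, ∑' k, z ^ k * d k = 0) (k : ℕ) : d k = 0 := by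
  induction k using Nat.strong_induction_on with
  | _ K ih =>
  have hbound : ∀ z ∈ Set.Ioo (0 : ℝ) 1, |d K| ≤ z * (1 - z)⁻¹ := by
    intro z hz
    have hgeo := summable_geometric_of_lt_one hz.1.le hz.2
    have hs : ∀ j, Summable fun k => z ^ k * d (k + j) := fun j =>
      Summable.of_norm_bounded hgeo fun k => by
        rw [Real.norm_eq_abs, abs_mul, abs_of_nonneg (pow_nonneg hz.1.le k)]
        exact mul_le_of_le_one_right (pow_nonneg hz.1.le k) (hd _)
    have h0 : ∑' k, z ^ (k + K) * d (k + K) = 0 := by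
      have hs0 : Summable fun k => z ^ k * d k := hs 0
      rw [← h z hz, ← hs0.sum_add_tsum_nat_add K]
      rw [Finset.sum_eq_zero fun j hj => by rw [ih j (Finset.mem_range.1 hj), mul_zero], zero_add]
    have h1 : ∑' k, z ^ k * d (k + K) = 0 := by
      have : ∀ k, z ^ (k + K) * d (k + K) = z ^ K * (z ^ k * d (k + K)) := fun k => by ring
      simp_rw [this, tsum_mul_left] at h0
      exact (mul_eq_zero.1 h0).resolve_left (pow_pos hz.1 K).ne'
    rw [(hs K).tsum_eq_zero_add] at h1
    have h2 : ∀ k, z ^ (k + 1) * d (k + 1 + K) = z * (z ^ k * d (k + (1 + K))) := fun k => by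
      rw [add_assoc]; ring
    simp_rw [h2, tsum_mul_left] at h1
    have h3 : d K = -(z * ∑' k, z ^ k * d (k + (1 + K))) := by
      simp only [pow_zero, one_mul, zero_add] at h1
      linarith
    rw [h3, abs_neg, abs_mul, abs_of_pos hz.1]
    refine mul_le_mul_of_nonneg_left ?_ hz.1.le
    rw [← tsum_geometric_of_lt_one hz.1.le hz.2, ← Real.norm_eq_abs]
    refine tsum_of_norm_bounded hgeo.hasSum fun k => ?_
    rw [Real.norm_eq_abs, abs_mul, abs_of_nonneg (pow_nonneg hz.1.le k)]
    exact mul_le_of_le_one_right (pow_nonneg hz.1.le k) (hd _)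
  have hlim : Filter.Tendsto (fun z : ℝ => z * (1 - z)⁻¹) (nhdsWithin 0 (Set.Ioi 0)) (nhds 0) := by
    have : ContinuousAt (fun z : ℝ => z * (1 - z)⁻¹) 0 := by
      refine continuousAt_id.mul (ContinuousAt.inv₀ (by fun_prop) (by norm_num))
    simpa using this.tendsto.mono_left nhdsWithin_le_nhds
  refine abs_eq_zero.1 (le_antisymm (ge_of_tendsto hlim ?_) (abs_nonneg _))
  filter_upwards [Ioo_mem_nhdsGT (zero_lt_one' ℝ)] with z hz using hbound z hz

lemma eq_of_tsum_pow_mul_eq {a b : ℕ → ℝ≥0∞} (ha : ∀ k, a k ≤ 1) (hb : ∀ k, b k ≤ 1)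
    (h : ∀ z ∈ Set.Ioo (0 : ℝ) 1,
      ∑' k, ENNReal.ofReal z ^ k * a k = ∑' k, ENNReal.ofReal z ^ k * b k) (k : ℕ) :
    a k = b k := by
  have hne : ∀ {c : ℕ → ℝ≥0∞}, (∀ k, c k ≤ 1) → ∀ k, c k ≠ ∞ := fun hc k =>
    ne_top_of_le_ne_top ENNReal.one_ne_top (hc k)
  have hr : ∀ {c : ℕ → ℝ≥0∞}, (∀ k, c k ≤ 1) → ∀ k, (c k).toReal ≤ 1 := fun hc k =>
    ENNReal.toReal_le_of_le_ofReal zero_le_one (by simpa using hc k)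
  have hsum : ∀ {c : ℕ → ℝ≥0∞}, (∀ k, c k ≤ 1) → ∀ z ∈ Set.Ioo (0 : ℝ) 1,
      Summable fun k => z ^ k * (c k).toReal := fun hc z hz =>
    Summable.of_nonneg_of_le
      (fun k => mul_nonneg (pow_nonneg hz.1.le k) ENNReal.toReal_nonneg)
      (fun k => mul_le_of_le_one_right (pow_nonneg hz.1.le k) (hr hc k))
      (summable_geometric_of_lt_one hz.1.le hz.2)
  have hreal : ∀ {c : ℕ → ℝ≥0∞}, (∀ k, c k ≤ 1) → ∀ z ∈ Set.Ioo (0 : ℝ) 1,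
      ∑' k, z ^ k * (c k).toReal = (∑' k, ENNReal.ofReal z ^ k * c k).toReal := by
    intro c hc z hz
    rw [ENNReal.tsum_toReal_eq fun k => ENNReal.mul_ne_top
      (ENNReal.pow_ne_top ENNReal.ofReal_ne_top) (hne hc k)]
    refine tsum_congr fun k => ?_
    rw [ENNReal.toReal_mul, ENNReal.toReal_pow, ENNReal.toReal_ofReal hz.1.le]
  have := eq_zero_of_tsum_pow_mul_eq_zero (d := fun k => (a k).toReal - (b k).toReal)
    (fun k => by
      rw [abs_le]
      have h1 := hr ha k
      have h2 := hr hb k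
      have h3 : 0 ≤ (a k).toReal := ENNReal.toReal_nonneg
      have h4 : 0 ≤ (b k).toReal := ENNReal.toReal_nonneg
      constructor <;> linarith)
    (fun z hz => by
      simp_rw [mul_sub]
      rw [(hsum ha z hz).tsum_sub (hsum hb z hz), hreal ha z hz, hreal hb z hz, h z hz, sub_self]) k
  exact (ENNReal.toReal_eq_toReal_iff' (hne ha k) (hne hb k)).1 (sub_eq_zero.1 this)

/-! ### The marking theorem. -/

section MarkedPoisson

variable {Ω : Type*} [MeasurableSpace Ω] {P : Measure Ω} [IsProbabilityMeasure P]
  {X : ℕ → Ω → Plane} {h : ℕ → Ω → ℝ} {ν : Measure ℝ} [IsProbabilityMeasure ν] {lam : ℝ}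
  {A : Set (Plane × ℝ)}

omit [IsProbabilityMeasure P] [IsProbabilityMeasure ν] in
lemma measurable_markedCount (hX : IsHomogeneousPoissonProcess P X lam)
    (hh : IsChannelGain P X h ν) (hA : MeasurableSet A) :
    Measurable fun ω => {i | (X i ω, h i ω) ∈ A}.encard :=
  measurable_encard_setOf fun i => ((hX.measurable i).prodMk (hh.measurable i)) hA

open Classical in
-- By Campbell's formula the count has finite mean.
lemma ae_markedCount_ne_top (hX : IsHomogeneousPoissonProcess P X lam)
    (hh : IsChannelGain P X h ν) (hA : MeasurableSet A)
    (hfin : ∫⁻ x, ν {g | (x, g) ∈ A} ≠ ∞) :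
    ∀ᵐ ω ∂P, {i | (X i ω, h i ω) ∈ A}.encard ≠ ⊤ := by
  have hF : Measurable (Function.uncurry fun x g => if (x, g) ∈ A then (1 : ℝ≥0∞) else 0) :=
    Measurable.ite hA measurable_const measurable_const
  have hp : ∀ x, ∫⁻ g, (if (x, g) ∈ A then (1 : ℝ≥0∞) else 0) ∂ν = ν {g | (x, g) ∈ A} := by
    intro x
    have hAx : MeasurableSet {g | (x, g) ∈ A} := measurable_prodMk_left hA
    rw [← lintegral_indicator_one hAx]
    rfl
  have hmean := hX.lintegral_tsum_marked hh hF
  simp_rw [hp] at hmean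
  have hm : Measurable fun ω => ∑' i, if (X i ω, h i ω) ∈ A then (1 : ℝ≥0∞) else 0 :=
    Measurable.tsum fun i => hF.comp ((hX.measurable i).prodMk (hh.measurable i))
  filter_upwards [ae_lt_top hm (by rw [hmean]; exact ENNReal.mul_ne_top ENNReal.coe_ne_top hfin)]
    with ω hω htop
  have := toENNReal_encard {i | (X i ω, h i ω) ∈ A}
  rw [htop] at this
  exact hω.ne this.symm

open Classical in
lemma tsum_pow_mul_markedCount (hX : IsHomogeneousPoissonProcess P X lam)
    (hh : IsChannelGain P X h ν) (hA : MeasurableSet A)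
    (hfin : ∫⁻ x, ν {g | (x, g) ∈ A} ≠ ∞) {z : ℝ} (hz : z ∈ Set.Ioo (0 : ℝ) 1) :
    ∑' k : ℕ, ENNReal.ofReal z ^ k * P {ω | {i | (X i ω, h i ω) ∈ A}.encard = k} =
      ENNReal.ofReal
        (Real.exp (-(lam.toNNReal * (∫⁻ x, ν {g | (x, g) ∈ A}).toReal * (1 - z)))) := by
  set N : Ω → ℕ∞ := fun ω => {i | (X i ω, h i ω) ∈ A}.encard with hN
  have hNm : Measurable N := measurable_markedCount hX hh hA
  have hNfin : ∀ᵐ ω ∂P, N ω ≠ ⊤ := ae_markedCount_ne_top hX hh hA hfin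
  have hNt : Measurable fun ω => (N ω).toNat := (Measurable.of_discrete (f := ENat.toNat)).comp hNm
  have hz1 : ENNReal.ofReal z ≤ 1 := ENNReal.ofReal_le_one.2 hz.2.le
  -- The product of these factors over all nodes is `z` to the number of marked points in `A`.
  let F : Plane → ℝ → ℝ≥0∞ := fun x g => if (x, g) ∈ A then ENNReal.ofReal z else 1
  have hF : Measurable (Function.uncurry F) :=
    Measurable.ite hA measurable_const measurable_const
  have hF1 : ∀ x g, F x g ≤ 1 := fun x g => by
    simp only [F]; split_ifs
    exacts [hz1, le_rfl]
  let w : Plane → ℝ≥0∞ := fun x => ∫⁻ g, F x g ∂ν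
  have hw : Measurable w := hF.lintegral_prod_right'
  have hw1 : ∀ x, w x ≤ 1 := fun x => (lintegral_mono (hF1 x)).trans (by simp)
  -- Averaging over the gain thins the process: a node at `x` counts with probability `ν {g | (x, g)
  -- ∈ A}`.
  have hsub : ∀ x, 1 - w x = ENNReal.ofReal (1 - z) * ν {g | (x, g) ∈ A} := by
    intro x
    have hAx : MeasurableSet {g | (x, g) ∈ A} := measurable_prodMk_left hA
    refine ENNReal.sub_eq_of_eq_add (ne_top_of_le_ne_top ENNReal.one_ne_top (hw1 x)) ?_
    rw [← lintegral_indicator_const hAx, ← lintegral_add_left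
      (measurable_const.indicator hAx)]
    rw [lintegral_congr (g := fun _ => 1) fun g => ?_]
    · simp
    · by_cases hg : (x, g) ∈ A
      · simp only [F, hg, Set.indicator, Set.mem_ofPred_eq, if_true]
        rw [← ENNReal.ofReal_add (by linarith [hz.2]) hz.1.le]
        simp
      · simp [F, hg, Set.indicator]
  have hwint : ∫⁻ x, (1 - w x) = ENNReal.ofReal (1 - z) * ∫⁻ x, ν {g | (x, g) ∈ A} := by
    simp_rw [hsub]
    exact lintegral_const_mul _ (measurable_measure_prodMk_left hA)
  calc ∑' k : ℕ, ENNReal.ofReal z ^ k * P {ω | N ω = k}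
      = ∫⁻ ω, ENNReal.ofReal z ^ (N ω).toNat ∂P := by
        rw [← lintegral_map (f := fun k => ENNReal.ofReal z ^ k) .of_discrete hNt,
          lintegral_countable']
        refine tsum_congr fun k => ?_
        rw [Measure.map_apply hNt (measurableSet_singleton k)]
        congr 1
        refine measure_congr ?_
        filter_upwards [hNfin] with ω hω
        refine propext ?_
        change N ω = k ↔ (N ω).toNat = k
        constructor
        · intro hk; simp [hk]
        · rintro rfl; exact (ENat.natCast_toNat hω).symm
    _ = ∫⁻ ω, ⨅ m, ∏ i ∈ Finset.range m, F (X i ω) (h i ω) ∂P := by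
        refine lintegral_congr_ae ?_
        filter_upwards [hNfin] with ω hω
        exact (iInf_prod_ite_eq_pow (S := {i | (X i ω, h i ω) ∈ A}) hz1
          (ENat.natCast_toNat hω).symm).symm
    -- Gains can be integrated out only in finite products, so the infimum leaves the integral here
    -- and returns afterwards.
    _ = ⨅ m, ∫⁻ ω, ∏ i ∈ Finset.range m, F (X i ω) (h i ω) ∂P :=
        lintegral_iInf (fun m => Finset.measurable_fun_prod _ fun i _ =>
            hF.comp ((hX.measurable i).prodMk (hh.measurable i)))
          (fun a b hab ω => antitone_prod_range (fun i => hF1 (X i ω) (h i ω)) hab) (by simp)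
    _ = ⨅ m, ∫⁻ ω, ∏ i ∈ Finset.range m, w (X i ω) ∂P :=
        iInf_congr fun m => hh.lintegral_prod_comp hX.measurable hF _
    _ = ∫⁻ ω, ⨅ m, ∏ i ∈ Finset.range m, w (X i ω) ∂P :=
        (lintegral_iInf (fun m => Finset.measurable_fun_prod _ fun i _ =>
            hw.comp (hX.measurable i))
          (fun a b hab ω => antitone_prod_range (fun i => hw1 (X i ω)) hab) (by simp)).symm
    _ = _ := by
        rw [hX.lintegral_iInf_prod hw hw1
          (by rw [hwint]; exact ENNReal.mul_ne_top ENNReal.ofReal_ne_top hfin), hwint,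
          ENNReal.toReal_mul, ENNReal.toReal_ofReal (by linarith [hz.2])]
        congr 3
        ring

/-- The marking theorem: the number of marked points in a set is Poisson distributed. -/
theorem markedCount_poisson (hX : IsHomogeneousPoissonProcess P X lam)
    (hh : IsChannelGain P X h ν) (hA : MeasurableSet A)
    (hfin : ∫⁻ x, ν {g | (x, g) ∈ A} ≠ ∞) (k : ℕ) :
    P {ω | {i | (X i ω, h i ω) ∈ A}.encard = k} =
      poissonMeasure (lam.toNNReal * (∫⁻ x, ν {g | (x, g) ∈ A}).toNNReal) {k} := by
  refine eq_of_tsum_pow_mul_eq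
    (a := fun k : ℕ => P {ω | {i | (X i ω, h i ω) ∈ A}.encard = k})
    (b := fun k => poissonMeasure _ {k})
    (fun k => prob_le_one) (fun k => prob_le_one) (fun z hz => ?_) k
  rw [tsum_pow_mul_markedCount hX hh hA hfin hz, tsum_poissonMeasure_mul_pow _ hz.1.le,
    NNReal.coe_mul]
  rfl

end MarkedPoisson

/-! ### Polar angle and integration over a sector. -/

lemma measurable_polarAngle : Measurable polarAngle := by
  have h : ∀ v : Plane, polarAngle v =
      Int.fract (Complex.arg ⟨v 0, v 1⟩ / (2 * Real.pi)) * (2 * Real.pi) := fun v => by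
    rw [polarAngle, toIcoMod_eq_fract_mul]
  have hc : Measurable fun v : Plane => (⟨v 0, v 1⟩ : ℂ) :=
    Complex.measurableEquivRealProd.symm.measurable.comp
      (f := fun v : Plane => (v 0, v 1)) (by fun_prop)
  rw [funext h]
  exact ((measurable_fract.comp ((Complex.measurable_arg.comp hc).div_const _))).mul_const _

lemma polarAngle_le_two_pi (v : Plane) : polarAngle v ≤ 2 * Real.pi := by
  have := (toIcoMod_mem_Ico Real.two_pi_pos 0 (Complex.arg ⟨v 0, v 1⟩)).2
  rw [zero_add] at this
  exact this.le

/-- The reduction to `[0, 2π)` fixes angles in `[0, π)` and adds `2π` to those in `(-π, 0)`. Up to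
endpoints the set consists of an interval from 0 to `min φ π` and one from `-π` to `φ - 2π`. -/
lemma volume_toIcoMod_le {φ : ℝ} (hφ' : φ ≤ 2 * Real.pi) :
    volume (Set.Ioo (-Real.pi) Real.pi ∩ {θ | toIcoMod Real.two_pi_pos 0 θ ≤ φ}) =
      ENNReal.ofReal φ := by
  have hpi := Real.pi_pos
  have hnonneg : ∀ θ, 0 ≤ θ → θ < Real.pi → toIcoMod Real.two_pi_pos 0 θ = θ := fun θ h0 h1 =>
    (toIcoMod_eq_self _).2 ⟨h0, by linarith⟩
  have hneg : ∀ θ, -Real.pi < θ → θ < 0 →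
      toIcoMod Real.two_pi_pos 0 θ = θ + 2 * Real.pi := fun θ h0 h1 => by
    rw [← toIcoMod_add_right Real.two_pi_pos]
    exact (toIcoMod_eq_self _).2 ⟨by linarith, by linarith⟩
  -- `ENNReal.ofReal` truncates at 0, so this also covers `φ ≤ π`, where the second interval has no
  -- length.
  have hsum : ENNReal.ofReal (min φ Real.pi) + ENNReal.ofReal (φ - Real.pi) =
      ENNReal.ofReal φ := by
    rcases le_total φ Real.pi with h | h
    · rw [min_eq_left h, ENNReal.ofReal_of_nonpos (by linarith : φ - Real.pi ≤ 0), add_zero]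
    · rw [min_eq_right h, ← ENNReal.ofReal_add hpi.le (by linarith)]
      congr 1; ring
  refine le_antisymm ?_ ?_
  · calc volume (Set.Ioo (-Real.pi) Real.pi ∩ {θ | toIcoMod Real.two_pi_pos 0 θ ≤ φ})
        ≤ volume (Set.Icc 0 (min φ Real.pi) ∪ Set.Icc (-Real.pi) (φ - 2 * Real.pi)) := by
          refine measure_mono ?_
          rintro θ ⟨⟨h1, h2⟩, h3⟩
          rw [Set.mem_ofPred_eq] at h3
          rcases le_or_gt 0 θ with h0 | h0
          · rw [hnonneg θ h0 h2] at h3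
            exact Or.inl ⟨h0, le_min h3 h2.le⟩
          · rw [hneg θ h1 h0] at h3
            exact Or.inr ⟨h1.le, by linarith⟩
      _ ≤ _ := measure_union_le _ _
      _ = ENNReal.ofReal φ := by
          rw [Real.volume_Icc, Real.volume_Icc, ← hsum]
          congr 2 <;> ring
  · calc ENNReal.ofReal φ
        = volume (Set.Ioo 0 (min φ Real.pi) ∪ Set.Ioo (-Real.pi) (φ - 2 * Real.pi)) := by
          rw [measure_union _ measurableSet_Ioo, Real.volume_Ioo, Real.volume_Ioo, ← hsum]
          · congr 2 <;> ring
          · rw [Set.disjoint_left]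
            rintro θ ⟨h1, -⟩ ⟨-, h2⟩
            linarith
      _ ≤ _ := by
          refine measure_mono ?_
          rintro θ (⟨h1, h2⟩ | ⟨h1, h2⟩)
          · have h3 : θ < Real.pi := h2.trans_le (min_le_right _ _)
            refine ⟨⟨by linarith, h3⟩, ?_⟩
            rw [Set.mem_ofPred_eq, hnonneg θ h1.le h3]
            exact (h2.trans_le (min_le_left _ _)).le
          · refine ⟨⟨h1, by linarith⟩, ?_⟩
            rw [Set.mem_ofPred_eq, hneg θ h1 (by linarith)]
            linarith

open Classical in
-- An isometry with `ℂ` gives access to polar coordinates, in which the integrand is a product of a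
-- function of the radius and one of the angle.
lemma lintegral_sector {φ : ℝ} (hφ' : φ ≤ 2 * Real.pi) {f : ℝ → ℝ≥0∞}
    (hf : Measurable f) :
    ∫⁻ x : Plane, (if polarAngle x ≤ φ then f ‖x‖ else 0) =
      ENNReal.ofReal φ * ∫⁻ r in Set.Ioi (0 : ℝ), ENNReal.ofReal r * f r := by
  have hG : Measurable fun x : Plane => if polarAngle x ≤ φ then f ‖x‖ else 0 :=
    Measurable.ite (measurableSet_le measurable_polarAngle measurable_const)
      (hf.comp measurable_norm) measurable_const
  have hT : MeasurableSet {θ | toIcoMod Real.two_pi_pos 0 θ ≤ φ} := by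
    refine measurableSet_le ?_ measurable_const
    have : toIcoMod Real.two_pi_pos 0 = fun θ : ℝ =>
        Int.fract (θ / (2 * Real.pi)) * (2 * Real.pi) :=
      funext fun θ => toIcoMod_eq_fract_mul _ _
    rw [this]
    exact (measurable_fract.comp (measurable_id.div_const _)).mul_const _
  have hpres := Complex.orthonormalBasisOneI.repr.measurePreserving
  rw [← hpres.lintegral_comp hG, ← Complex.lintegral_comp_polarCoord_symm, polarCoord_target]
  have hcongr : ∀ p ∈ Set.Ioi (0 : ℝ) ×ˢ Set.Ioo (-Real.pi) Real.pi,
      ENNReal.ofReal p.1 • (if polarAngle (Complex.orthonormalBasisOneI.repr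
        (Complex.polarCoord.symm p)) ≤ φ then
          f ‖Complex.orthonormalBasisOneI.repr (Complex.polarCoord.symm p)‖ else 0) =
      (ENNReal.ofReal p.1 * f p.1) *
        {θ | toIcoMod Real.two_pi_pos 0 θ ≤ φ}.indicator (fun _ => 1) p.2 := by
    rintro ⟨r, θ⟩ ⟨hr, hθ⟩
    have hr' : (0 : ℝ) < r := hr
    have hang : polarAngle (Complex.orthonormalBasisOneI.repr (Complex.polarCoord.symm (r, θ))) =
        toIcoMod Real.two_pi_pos 0 θ := by
      have h1 : (⟨Complex.orthonormalBasisOneI.repr (Complex.polarCoord.symm (r, θ)) 0,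
          Complex.orthonormalBasisOneI.repr (Complex.polarCoord.symm (r, θ)) 1⟩ : ℂ) =
          Complex.polarCoord.symm (r, θ) :=
        Complex.ext (by simp) (by simp)
      rw [polarAngle, h1, Complex.polarCoord_symm_apply, Complex.ofReal_cos, Complex.ofReal_sin,
        Complex.arg_mul_cos_add_sin_mul_I hr' ⟨hθ.1, hθ.2.le⟩]
    rw [hang, LinearIsometryEquiv.norm_map, Complex.norm_polarCoord_symm, abs_of_pos hr']
    by_cases h : toIcoMod Real.two_pi_pos 0 θ ≤ φ <;> simp [h, Set.indicator]
  rw [setLIntegral_congr_fun (measurableSet_Ioi.prod measurableSet_Ioo) hcongr,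
    Measure.volume_eq_prod, ← Measure.prod_restrict,
    lintegral_prod_mul (f := fun r => ENNReal.ofReal r * f r) (by fun_prop)
      (measurable_const.indicator hT).aemeasurable,
    lintegral_indicator_const hT, Measure.restrict_apply hT, Set.inter_comm,
    volume_toIcoMod_le hφ', one_mul, mul_comm]

lemma lintegral_norm_plane {f : ℝ → ℝ≥0∞} (hf : Measurable f) :
    ∫⁻ x : Plane, f ‖x‖ =
      ENNReal.ofReal (2 * Real.pi) * ∫⁻ r in Set.Ioi (0 : ℝ), ENNReal.ofReal r * f r := by
  rw [← lintegral_sector le_rfl hf]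
  simp [polarAngle_le_two_pi]

/-! ### Poisson tails and the Gamma integral. -/

/-- The weight `e⁻ˢ sᵏ / k!` of the Poisson distribution. -/
noncomputable def poissonWeight (s : ℝ) (k : ℕ) : ℝ := Real.exp (-s) * s ^ k / k.factorial

/-- The probability that a Poisson random variable with mean `s` is at least `k`. -/
noncomputable def poissonTail (k : ℕ) (s : ℝ) : ℝ := 1 - ∑ j ∈ Finset.range k, poissonWeight s j

lemma poissonWeight_nonneg {s : ℝ} (hs : 0 ≤ s) (k : ℕ) : 0 ≤ poissonWeight s k := by
  unfold poissonWeight; positivity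

lemma continuous_poissonWeight (k : ℕ) : Continuous fun s => poissonWeight s k := by
  unfold poissonWeight; fun_prop

lemma continuous_poissonTail (k : ℕ) : Continuous (poissonTail k) :=
  continuous_const.sub (continuous_finsetSum _ fun j _ => continuous_poissonWeight j)

/-- The derivative of the weight `k + 1` is weight `k` minus weight `k + 1`, so the sum telescopes.
-/
lemma hasDerivAt_poissonTail_succ (k : ℕ) (s : ℝ) :
    HasDerivAt (poissonTail (k + 1)) (poissonWeight s k) s := by
  have hexp : HasDerivAt (fun s : ℝ => Real.exp (-s)) (-Real.exp (-s)) s := by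
    simpa using (hasDerivAt_neg s).exp
  induction k with
  | zero =>
    have h : poissonTail (0 + 1) = fun s => 1 - Real.exp (-s) := by
      funext s; simp [poissonTail, poissonWeight]
    rw [h]
    simpa [poissonWeight] using hexp.const_sub 1
  | succ k ih =>
    have h : poissonTail (k + 1 + 1) = fun s => poissonTail (k + 1) s - poissonWeight s (k + 1) := by
      funext s; rw [poissonTail, Finset.sum_range_succ, poissonTail]; ring
    have hw : HasDerivAt (fun s => poissonWeight s (k + 1))
        (poissonWeight s k - poissonWeight s (k + 1)) s := by
      unfold poissonWeight
      convert! (hexp.mul (hasDerivAt_pow (k + 1) s)).div_const ((k + 1).factorial : ℝ) using 1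
      rw [Nat.factorial_succ]
      push_cast
      field_simp
      ring
    rw [h]
    convert! ih.sub hw using 1
    ring

lemma poissonTail_succ_zero (k : ℕ) : poissonTail (k + 1) 0 = 0 := by
  simp [poissonTail, poissonWeight, Finset.sum_range_succ']

lemma setLIntegral_poissonWeight (k : ℕ) {r : ℝ} (hr : 0 ≤ r) :
    ∫⁻ s in Set.Ioc 0 r, ENNReal.ofReal (poissonWeight s k) =
      ENNReal.ofReal (poissonTail (k + 1) r) := by
  have hc := continuous_poissonWeight k
  rw [← ofReal_integral_eq_lintegral_ofReal
      (hc.integrableOn_Ioc) ((ae_restrict_iff' measurableSet_Ioc).2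
        (.of_forall fun s hs => poissonWeight_nonneg hs.1.le k)),
    ← intervalIntegral.integral_of_le hr,
    intervalIntegral.integral_eq_sub_of_hasDerivAt
      (fun s _ => hasDerivAt_poissonTail_succ k s) (hc.intervalIntegrable _ _),
    poissonTail_succ_zero, sub_zero]

lemma tsum_ofReal_poissonWeight_add (k : ℕ) {s : ℝ} (hs : 0 ≤ s) :
    ∑' j, ENNReal.ofReal (poissonWeight s (j + k)) = ENNReal.ofReal (poissonTail k s) := by
  have h1 : HasSum (poissonWeight s) 1 := hasSum_one_poissonMeasure ⟨s, hs⟩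
  have h2 := (hasSum_nat_add_iff' k).2 h1
  rw [← ENNReal.ofReal_tsum_of_nonneg (fun j => poissonWeight_nonneg hs _) h2.summable, h2.tsum_eq]
  rfl

lemma measure_le_of_poisson {Ω : Type*} [MeasurableSpace Ω] {P : Measure Ω}
    [IsProbabilityMeasure P] {N : Ω → ℕ∞} {r : ℝ≥0} (hN : Measurable N)
    (h : ∀ k : ℕ, P {ω | N ω = k} = poissonMeasure r {k}) (k : ℕ) :
    P {ω | (k : ℕ∞) ≤ N ω} = ENNReal.ofReal (poissonTail k r) := by
  classical
  have hm : MeasurableSet {ω | (k : ℕ∞) ≤ N ω} := hN (MeasurableSet.of_discrete (s := Set.Ici _))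
  have := lintegral_comp_of_poisson hN h fun a => if (k : ℕ∞) ≤ a then 1 else 0
  rw [← lintegral_indicator_one hm]
  refine Eq.trans ?_ (this.trans ?_)
  · refine lintegral_congr fun ω => ?_
    by_cases hω : (k : ℕ∞) ≤ N ω <;> simp [hω]
  · rw [← tsum_ofReal_poissonWeight_add k r.coe_nonneg, ← ENNReal.summable.sum_add_tsum_nat_add' (k := k),
      Finset.sum_eq_zero fun j hj => ?_, zero_add]
    · refine tsum_congr fun j => ?_
      rw [if_pos (by exact_mod_cast Nat.le_add_left k j), one_mul, poissonMeasure_singleton]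
      rfl
    · rw [if_neg (by simpa using hj), zero_mul]

lemma setLIntegral_Ioc_eq_Ioi (m : ℝ) (g : ℝ → ℝ≥0∞) :
    ∫⁻ s in Set.Ioc 0 m, g s = ∫⁻ s in Set.Ioi (0 : ℝ), if s ≤ m then g s else 0 := by
  rw [← lintegral_indicator measurableSet_Ioc, ← lintegral_indicator measurableSet_Ioi]
  refine lintegral_congr fun s => ?_
  by_cases h1 : 0 < s <;> by_cases h2 : s ≤ m <;> simp [Set.indicator, h1, h2]

/-- Each tail is the integral of one weight. Summing the weights under the integral gives a tail
again. -/
lemma tsum_ofReal_poissonTail (l : ℕ) {m : ℝ} (hm : 0 ≤ m) :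
    ∑' k, ENNReal.ofReal (poissonTail (l + 1 + 1 + k) m) =
      ∫⁻ s in Set.Ioc 0 m, ENNReal.ofReal (poissonTail (l + 1) s) := by
  have h : ∀ k, ENNReal.ofReal (poissonTail (l + 1 + 1 + k) m) =
      ∫⁻ s in Set.Ioc 0 m, ENNReal.ofReal (poissonWeight s (k + (l + 1))) := fun k => by
    rw [setLIntegral_poissonWeight _ hm]
    congr 2; ring
  simp_rw [h]
  rw [← lintegral_tsum fun k => (continuous_poissonWeight _).measurable.ennreal_ofReal.aemeasurable]
  exact setLIntegral_congr_fun measurableSet_Ioc fun s hs =>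
    tsum_ofReal_poissonWeight_add (l + 1) hs.1.le

lemma le_mul_rpow_neg_inv_iff {β c s t : ℝ} (hβ : 0 < β) (hc : 0 < c) (hs : 0 < s) (ht : 0 < t) :
    s ≤ c * t ^ (-β⁻¹) ↔ t ≤ c ^ β * s ^ (-β) := by
  have h1 : c * t ^ (-β⁻¹) = c / t ^ β⁻¹ := by rw [Real.rpow_neg ht.le, div_eq_mul_inv]
  have h2 : c ^ β * s ^ (-β) = (c / s) ^ β := by
    rw [Real.rpow_neg hs.le, Real.div_rpow hc.le hs.le, div_eq_mul_inv]
  have h3 : 0 < t ^ β⁻¹ := Real.rpow_pos_of_pos ht _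
  rw [h1, h2, le_div_iff₀ h3, mul_comm, ← le_div_iff₀ hs,
    Real.rpow_inv_le_iff_of_pos ht.le (by positivity) hβ]

lemma setLIntegral_Ioi_rpow_neg {β u : ℝ} (hβ : 1 < β) (hu : 0 < u) :
    ∫⁻ s in Set.Ioi u, ENNReal.ofReal (s ^ (-β)) = ENNReal.ofReal (u ^ (1 - β) / (β - 1)) := by
  rw [← ofReal_integral_eq_lintegral_ofReal (integrableOn_Ioi_rpow_of_lt (by linarith) hu)
      ((ae_restrict_iff' measurableSet_Ioi).2
        (.of_forall fun s hs => Real.rpow_nonneg (hu.trans hs).le _)),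
    integral_Ioi_rpow_of_lt (by linarith) hu, neg_div, ← div_neg]
  congr 2 <;> ring_nf

lemma lintegral_gamma {s : ℝ} (hs : 0 < s) :
    ∫⁻ u in Set.Ioi (0 : ℝ), ENNReal.ofReal (Real.exp (-u) * u ^ (s - 1)) =
      ENNReal.ofReal (Real.Gamma s) := by
  rw [Real.Gamma_eq_integral hs, ofReal_integral_eq_lintegral_ofReal
    (Real.GammaIntegral_convergent hs) ((ae_restrict_iff' measurableSet_Ioi).2
        (.of_forall fun u hu => mul_nonneg (Real.exp_pos _).le (Real.rpow_nonneg (le_of_lt hu) _)))]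

lemma lintegral_swap_Ioi {R : ℝ → ℝ → Prop} [∀ t s, Decidable (R t s)]
    (hR : MeasurableSet {p : ℝ × ℝ | R p.1 p.2}) {f : ℝ → ℝ → ℝ≥0∞}
    (hf : Measurable (Function.uncurry f)) :
    ∫⁻ t in Set.Ioi (0 : ℝ), ∫⁻ s in Set.Ioi (0 : ℝ), (if R t s then f t s else 0) =
      ∫⁻ s in Set.Ioi (0 : ℝ), ∫⁻ t in Set.Ioi (0 : ℝ), (if R t s then f t s else 0) :=
  lintegral_lintegral_swap (Measurable.ite hR hf measurable_const).aemeasurable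

/-- If the number of points above each level `t` is Poisson distributed with mean
`c * t ^ (-1 / β)`, this is the mean of the sum of all but the `l + 1` largest points. -/
lemma tsum_lintegral_poissonTail (l : ℕ) {β c : ℝ} (hβ : 1 < β) (hβl : β < l + 2) (hc : 0 < c) :
    ∑' k, ∫⁻ t in Set.Ioi (0 : ℝ), ENNReal.ofReal (poissonTail (l + 1 + 1 + k) (c * t ^ (-β⁻¹))) =
      ENNReal.ofReal (c ^ β * Real.Gamma (l + 2 - β) / ((β - 1) * l.factorial)) := by
  have hmeas : Measurable fun t : ℝ => c * t ^ (-β⁻¹) := by fun_prop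
  have hcβ : 0 < c ^ β := Real.rpow_pos_of_pos hc _
  have hWm : Measurable fun u => ENNReal.ofReal (poissonWeight u l) :=
    (continuous_poissonWeight l).measurable.ennreal_ofReal
  have hTm : Measurable fun s => ENNReal.ofReal (poissonTail (l + 1) s) :=
    (continuous_poissonTail _).measurable.ennreal_ofReal
  have hvol : ∀ s ∈ Set.Ioi (0 : ℝ), ∫⁻ t in Set.Ioi (0 : ℝ),
      (if s ≤ c * t ^ (-β⁻¹) then ENNReal.ofReal (poissonTail (l + 1) s) else 0) =
      ENNReal.ofReal (c ^ β * s ^ (-β)) * ENNReal.ofReal (poissonTail (l + 1) s) := by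
    intro s hs
    rw [setLIntegral_congr_fun (g := fun t => if t ≤ c ^ β * s ^ (-β) then
        ENNReal.ofReal (poissonTail (l + 1) s) else 0) measurableSet_Ioi fun t ht =>
        if_congr (le_mul_rpow_neg_inv_iff (by linarith) hc hs ht) rfl rfl, ← setLIntegral_Ioc_eq_Ioi]
    simp [mul_comm]
  -- Here `β > 1` makes the integral over `s` converge. The remaining power of `u` is the Gamma
  -- integrand at `l + 2 - β`, whose positivity is `hβl`.
  have hinner : ∀ u ∈ Set.Ioi (0 : ℝ), ∫⁻ s in Set.Ioi (0 : ℝ),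
      (if u ≤ s then ENNReal.ofReal (c ^ β * s ^ (-β)) * ENNReal.ofReal (poissonWeight u l) else 0) =
      ENNReal.ofReal (c ^ β / ((β - 1) * l.factorial)) *
        ENNReal.ofReal (Real.exp (-u) * u ^ (l + 2 - β - 1)) := by
    intro u hu
    have hu' : 0 < u := hu
    have h1 : ∫⁻ s in Set.Ioi (0 : ℝ), (if u ≤ s then
        ENNReal.ofReal (c ^ β * s ^ (-β)) * ENNReal.ofReal (poissonWeight u l) else 0) =
        ∫⁻ s in Set.Ioi u,
          ENNReal.ofReal (c ^ β * s ^ (-β)) * ENNReal.ofReal (poissonWeight u l) := by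
      rw [setLIntegral_congr (Ioi_ae_eq_Ici (a := u)), ← lintegral_indicator measurableSet_Ioi,
        ← lintegral_indicator measurableSet_Ici]
      refine lintegral_congr fun s => ?_
      by_cases h : u ≤ s
      · simp [Set.indicator, h, hu'.trans_le h]
      · simp [Set.indicator, h]
    rw [h1, lintegral_mul_const _ (by fun_prop)]
    simp_rw [ENNReal.ofReal_mul hcβ.le]
    rw [lintegral_const_mul _ (by fun_prop), setLIntegral_Ioi_rpow_neg hβ hu',
      ← ENNReal.ofReal_mul hcβ.le, ← ENNReal.ofReal_mul (by
        have : 0 < β - 1 := by linarith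
        positivity), ← ENNReal.ofReal_mul (by
        have : 0 < β - 1 := by linarith
        positivity)]
    congr 1
    have h2 : u ^ ((l : ℝ) + 2 - β - 1) = u ^ (1 - β) * u ^ l := by
      rw [← Real.rpow_natCast, ← Real.rpow_add hu']
      congr 1; ring
    have h3 : β - 1 ≠ 0 := by linarith
    rw [h2, poissonWeight]
    field_simp
  calc ∑' k, ∫⁻ t in Set.Ioi (0 : ℝ),
        ENNReal.ofReal (poissonTail (l + 1 + 1 + k) (c * t ^ (-β⁻¹)))
      = ∫⁻ t in Set.Ioi (0 : ℝ), ∫⁻ s in Set.Ioi (0 : ℝ),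
          if s ≤ c * t ^ (-β⁻¹) then ENNReal.ofReal (poissonTail (l + 1) s) else 0 := by
        rw [← lintegral_tsum
          (f := fun k t => ENNReal.ofReal (poissonTail (l + 1 + 1 + k) (c * t ^ (-β⁻¹)))) fun k =>
          ((continuous_poissonTail _).measurable.comp hmeas).ennreal_ofReal.aemeasurable]
        refine setLIntegral_congr_fun measurableSet_Ioi fun t ht => ?_
        rw [tsum_ofReal_poissonTail l (mul_nonneg hc.le (Real.rpow_nonneg (le_of_lt ht) _)),
          setLIntegral_Ioc_eq_Ioi]
    _ = ∫⁻ s in Set.Ioi (0 : ℝ),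
          ENNReal.ofReal (c ^ β * s ^ (-β)) * ENNReal.ofReal (poissonTail (l + 1) s) := by
        rw [lintegral_swap_Ioi (R := fun t s => s ≤ c * t ^ (-β⁻¹))
          (f := fun _ s => ENNReal.ofReal (poissonTail (l + 1) s))
          (measurableSet_le measurable_snd (hmeas.comp measurable_fst)) (hTm.comp measurable_snd)]
        exact setLIntegral_congr_fun measurableSet_Ioi hvol
    _ = ∫⁻ s in Set.Ioi (0 : ℝ), ∫⁻ u in Set.Ioi (0 : ℝ), if u ≤ s then
          ENNReal.ofReal (c ^ β * s ^ (-β)) * ENNReal.ofReal (poissonWeight u l) else 0 := by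
        refine setLIntegral_congr_fun measurableSet_Ioi fun s hs => ?_
        rw [← setLIntegral_poissonWeight l (le_of_lt hs), ← lintegral_const_mul _ hWm,
          setLIntegral_Ioc_eq_Ioi]
    _ = ∫⁻ u in Set.Ioi (0 : ℝ), ENNReal.ofReal (c ^ β / ((β - 1) * l.factorial)) *
          ENNReal.ofReal (Real.exp (-u) * u ^ (l + 2 - β - 1)) := by
        rw [lintegral_swap_Ioi (R := fun s u => u ≤ s)
          (f := fun s u => ENNReal.ofReal (c ^ β * s ^ (-β)) * ENNReal.ofReal (poissonWeight u l))
          (measurableSet_le measurable_snd measurable_fst)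
          ((Measurable.ennreal_ofReal (by fun_prop)).mul (hWm.comp measurable_snd))]
        exact setLIntegral_congr_fun measurableSet_Ioi hinner
    _ = _ := by
        rw [lintegral_const_mul _ (by fun_prop), lintegral_gamma (by linarith),
          ← ENNReal.ofReal_mul (by
            have : 0 < β - 1 := by linarith
            positivity)]
        congr 1
        ring

/-- Layer-cake formula for the `k`-th largest value. -/
lemma kthLargest_eq_volume (S : Set ℕ) (a : ℕ → ℝ≥0∞) (k : ℕ) :
    kthLargest S a k =
      volume {t : ℝ | 0 < t ∧ (k : ℕ∞) ≤ {i ∈ S | ENNReal.ofReal t ≤ a i}.encard} := by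
  set D : Set ℝ≥0∞ := {t | (k : ℕ∞) ≤ {i ∈ S | t ≤ a i}.encard} with hD
  -- `D` is closed downwards, hence an interval starting at 0. Its length is its supremum, attained
  -- or not.
  have hdown : ∀ {s t : ℝ≥0∞}, s ≤ t → t ∈ D → s ∈ D := fun hst ht =>
    le_trans (show (k : ℕ∞) ≤ _ from ht) (Set.encard_le_encard fun i hi => ⟨hi.1, hst.trans hi.2⟩)
  change sSup D = volume {t : ℝ | 0 < t ∧ ENNReal.ofReal t ∈ D}
  refine le_antisymm (le_of_forall_lt fun c hc => ?_) ?_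
  · obtain ⟨c', hcc', hc'⟩ := exists_between hc
    obtain ⟨d, hd, hcd⟩ := lt_sSup_iff.1 hc'
    refine hcc'.trans_le ?_
    have hc'top : c' ≠ ∞ := (hc'.trans_le le_top).ne
    calc c' = volume (Set.Ioc 0 c'.toReal) := by
          rw [Real.volume_Ioc, sub_zero, ENNReal.ofReal_toReal hc'top]
      _ ≤ volume {t : ℝ | 0 < t ∧ ENNReal.ofReal t ∈ D} := measure_mono fun t ht =>
          ⟨ht.1, hdown ((ENNReal.ofReal_le_of_le_toReal ht.2).trans hcd.le) hd⟩
  · by_cases htop : sSup D = ∞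
    · rw [htop]; exact le_top
    calc volume {t : ℝ | 0 < t ∧ ENNReal.ofReal t ∈ D}
        ≤ volume (Set.Ioc 0 (sSup D).toReal) := measure_mono fun t ht =>
          ⟨ht.1, (ENNReal.ofReal_le_iff_le_toReal htop).1 (le_sSup ht.2)⟩
      _ = sSup D := by rw [Real.volume_Ioc, sub_zero, ENNReal.ofReal_toReal htop]

/-! ### The two mean interferences and the radius that equates them. -/

section Interference

variable {Ω : Type*} [MeasurableSpace Ω] {P : Measure Ω} [IsProbabilityMeasure P]
  {X : ℕ → Ω → Plane} {h : ℕ → Ω → ℝ} {ν : Measure ℝ} [IsProbabilityMeasure ν]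
  {lam α φ : ℝ} {rx : Plane}

lemma measurable_interferencePower (α : ℝ) (rx : Plane) :
    Measurable (Function.uncurry (interferencePower α rx)) := by
  unfold interferencePower Function.uncurry
  fun_prop

lemma setLIntegral_ofReal_mul_rpow (hα : 2 < α) {R : ℝ} (hR : 0 < R) :
    ∫⁻ r in Set.Ioi (0 : ℝ),
        ENNReal.ofReal r * (if r < R then 0 else ENNReal.ofReal (r ^ (-α))) =
      ENNReal.ofReal (R ^ (2 - α) / (α - 2)) := by
  have h1 : ∫⁻ r in Set.Ioi (0 : ℝ),
      ENNReal.ofReal r * (if r < R then 0 else ENNReal.ofReal (r ^ (-α))) =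
      ∫⁻ r in Set.Ioi R, ENNReal.ofReal (r ^ (-(α - 1))) := by
    rw [setLIntegral_congr (Ioi_ae_eq_Ici (a := R)), ← lintegral_indicator measurableSet_Ioi,
      ← lintegral_indicator measurableSet_Ici]
    refine lintegral_congr fun r => ?_
    by_cases h : R ≤ r
    · have hr : 0 < r := hR.trans_le h
      rw [Set.indicator_of_mem (show r ∈ Set.Ioi 0 from hr), Set.indicator_of_mem
        (show r ∈ Set.Ici R from h), if_neg h.not_gt, ← ENNReal.ofReal_mul hr.le,
        show -(α - 1) = 1 + -α by ring, Real.rpow_add hr, Real.rpow_one]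
    · have h' : r < R := not_le.1 h
      rw [Set.indicator_of_notMem (show r ∉ Set.Ici R from h)]
      simp [Set.indicator, h']
  rw [h1, setLIntegral_Ioi_rpow_neg (by linarith) hR]
  congr 2
  · congr 1; ring
  · ring

lemma lintegral_outsideInterference (hlam : 0 < lam) (hα : 2 < α)
    (hX : IsHomogeneousPoissonProcess P X lam) (hh : IsChannelGain P X h ν)
    (hpos : ∀ᵐ t ∂ν, 0 < t) (hint : Integrable (fun t : ℝ => t) ν) {R : ℝ} (hR : 0 < R) :
    ∫⁻ ω, outsideInterference α rx R (fun i => X i ω) (fun i => h i ω) ∂P =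
      ENNReal.ofReal (2 * Real.pi * lam * (∫ t, t ∂ν) * R ^ (2 - α) / (α - 2)) := by
  classical
  have hF : Measurable (Function.uncurry fun x g =>
      if x ∈ Metric.ball rx R then 0 else interferencePower α rx x g) :=
    Measurable.ite (Metric.isOpen_ball.measurableSet.preimage measurable_fst) measurable_const
      (measurable_interferencePower α rx)
  let f : ℝ → ℝ≥0∞ := fun r => if r < R then 0 else ENNReal.ofReal (r ^ (-α))
  have hf : Measurable f := Measurable.ite (measurableSet_lt measurable_id measurable_const)
    measurable_const (by fun_prop)
  -- Position and gain separate, so only `E[h]` survives. Translation invariance later moves the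
  -- receiver to the origin.
  have hinner : ∀ x, ∫⁻ g, (if x ∈ Metric.ball rx R then 0 else interferencePower α rx x g) ∂ν =
      f ‖x - rx‖ * ENNReal.ofReal (∫ t, t ∂ν) := by
    intro x
    rw [ofReal_integral_eq_lintegral_ofReal hint (hpos.mono fun t ht => ht.le)]
    by_cases hx : ‖x - rx‖ < R
    · simp only [f, hx, mem_ball_iff_norm, if_true, lintegral_zero, zero_mul]
    · simp only [f, hx, mem_ball_iff_norm, if_false, interferencePower]
      rw [norm_sub_rev rx x, ← lintegral_const_mul _ (by fun_prop)]
      refine lintegral_congr fun g => ?_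
      rw [mul_comm, ENNReal.ofReal_mul (by positivity)]
  have hE : 0 ≤ ∫ t, t ∂ν := integral_nonneg_of_ae (hpos.mono fun t ht => ht.le)
  unfold outsideInterference
  rw [hX.lintegral_tsum_marked hh hF]
  simp_rw [hinner]
  rw [lintegral_mul_const _ (by fun_prop),
    lintegral_sub_right_eq_self (fun x => f ‖x‖) rx, lintegral_norm_plane hf,
    setLIntegral_ofReal_mul_rpow hα hR]
  change ENNReal.ofReal lam * _ = _
  have h2 : 0 < R ^ (2 - α) / (α - 2) := div_pos (Real.rpow_pos_of_pos hR _) (by linarith)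
  have hpi := Real.pi_pos
  rw [← ENNReal.ofReal_mul (by positivity), ← ENNReal.ofReal_mul (by positivity),
    ← ENNReal.ofReal_mul hlam.le]
  congr 1
  ring

/-- The positions and gains of the nodes received within the reception angle with power at
least `t`. -/
def strongNodes (α φ : ℝ) (rx : Plane) (t : ℝ) : Set (Plane × ℝ) :=
  {p | polarAngle (p.1 - rx) ≤ φ ∧ ENNReal.ofReal t ≤ interferencePower α rx p.1 p.2}

lemma measurableSet_strongNodes_uncurry (α φ : ℝ) (rx : Plane) :
    MeasurableSet {p : (Plane × ℝ) × ℝ | p.1 ∈ strongNodes α φ rx p.2} := by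
  have h1 : MeasurableSet {p : (Plane × ℝ) × ℝ | polarAngle (p.1.1 - rx) ≤ φ} :=
    measurableSet_le (measurable_polarAngle.comp (by fun_prop)) measurable_const
  have h2 : MeasurableSet {p : (Plane × ℝ) × ℝ |
      ENNReal.ofReal p.2 ≤ interferencePower α rx p.1.1 p.1.2} :=
    measurableSet_le (by fun_prop) ((measurable_interferencePower α rx).comp measurable_fst)
  exact h1.inter h2

lemma measurableSet_strongNodes (α φ : ℝ) (rx : Plane) (t : ℝ) :
    MeasurableSet (strongNodes α φ rx t) :=
  (measurableSet_strongNodes_uncurry α φ rx).preimage (measurable_prodMk_right (y := t))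

/-- The power reaches `t` exactly for `r ≤ (g / t) ^ α⁻¹`, and integrating `r` gives half the square
of that radius. -/
lemma setLIntegral_ofReal_ite_le (hα : 2 < α) {g t : ℝ} (hg : 0 < g) (ht : 0 < t) :
    ∫⁻ r in Set.Ioi (0 : ℝ),
        ENNReal.ofReal r * (if ENNReal.ofReal t ≤ ENNReal.ofReal (g * r ^ (-α)) then 1 else 0) =
      ENNReal.ofReal (g ^ (2 / α) * (t ^ (-(2 / α)) / 2)) := by
  have hgt : 0 < g / t := div_pos hg ht
  have hM : 0 < (g / t) ^ α⁻¹ := Real.rpow_pos_of_pos hgt _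
  have h1 : ∀ r ∈ Set.Ioi (0 : ℝ), ENNReal.ofReal r *
      (if ENNReal.ofReal t ≤ ENNReal.ofReal (g * r ^ (-α)) then 1 else 0) =
      if r ≤ (g / t) ^ α⁻¹ then ENNReal.ofReal r else 0 := by
    intro r hr
    have hr' : 0 < r := hr
    have hrα : 0 < r ^ α := Real.rpow_pos_of_pos hr' _
    have hiff : ENNReal.ofReal t ≤ ENNReal.ofReal (g * r ^ (-α)) ↔ r ≤ (g / t) ^ α⁻¹ := by
      rw [ENNReal.ofReal_le_ofReal_iff (by positivity), Real.rpow_neg hr'.le, ← div_eq_mul_inv,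
        le_div_iff₀ hrα, mul_comm, ← le_div_iff₀ ht,
        Real.le_rpow_inv_iff_of_pos hr'.le hgt.le (by linarith)]
    by_cases hc : r ≤ (g / t) ^ α⁻¹
    · rw [if_pos (hiff.2 hc), if_pos hc, mul_one]
    · rw [if_neg fun hn => hc (hiff.1 hn), if_neg hc, mul_zero]
  have hid : IntegrableOn (fun r : ℝ => r) (Set.Ioc 0 ((g / t) ^ α⁻¹)) :=
    continuous_id.integrableOn_Ioc
  rw [setLIntegral_congr_fun measurableSet_Ioi h1, ← setLIntegral_Ioc_eq_Ioi,
    ← ofReal_integral_eq_lintegral_ofReal hid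
      ((ae_restrict_iff' measurableSet_Ioc).2 (.of_forall fun r hr => hr.1.le)),
    ← intervalIntegral.integral_of_le hM.le]
  rw [integral_id]
  congr 1
  have h2 : ((g / t) ^ α⁻¹) ^ 2 = g ^ (2 / α) * t ^ (-(2 / α)) := by
    have hexp : α⁻¹ * ((2 : ℕ) : ℝ) = 2 / α := by push_cast; ring
    rw [← Real.rpow_natCast, ← Real.rpow_mul hgt.le, hexp, Real.div_rpow hg.le ht.le,
      Real.rpow_neg ht.le, div_eq_mul_inv]
  rw [h2]
  ring

/-- The bound `t ^ s ≤ 1 + t` is why a finite mean of the gain suffices for the moment of order `2 /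
α < 1`. -/
lemma integrable_rpow_of_le_one (hpos : ∀ᵐ t ∂ν, 0 < t)
    (hint : Integrable (fun t : ℝ => t) ν) {s : ℝ} (hs : 0 ≤ s) (hs1 : s ≤ 1) :
    Integrable (fun t : ℝ => t ^ s) ν := by
  refine ((integrable_const (1 : ℝ)).add hint).mono' (by fun_prop) ?_
  filter_upwards [hpos] with t ht
  rw [Real.norm_of_nonneg (Real.rpow_nonneg ht.le _)]
  change t ^ s ≤ 1 + t
  rcases le_total t 1 with h1 | h1
  · linarith [Real.rpow_le_one ht.le h1 hs]
  · have := Real.rpow_le_rpow_of_exponent_le h1 hs1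
    rw [Real.rpow_one] at this
    linarith

/-- The mean number of nodes received with power at least `t`, per unit intensity. -/
lemma lintegral_measure_strongNodes (hα : 2 < α) (hφ : 0 < φ) (hφ' : φ ≤ 2 * Real.pi)
    (hpos : ∀ᵐ t ∂ν, 0 < t) (hint : Integrable (fun t : ℝ => t) ν) {t : ℝ} (ht : 0 < t) :
    ∫⁻ x, ν {g | (x, g) ∈ strongNodes α φ rx t} =
      ENNReal.ofReal (φ * gainMoment ν (2 / α) / 2 * t ^ (-(2 / α))) := by
  classical
  have hA := measurableSet_strongNodes α φ rx t
  have hind : ∀ x, ν {g | (x, g) ∈ strongNodes α φ rx t} =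
      ∫⁻ g, (if (x, g) ∈ strongNodes α φ rx t then 1 else 0) ∂ν := by
    intro x
    have hAx : MeasurableSet {g | (x, g) ∈ strongNodes α φ rx t} := measurable_prodMk_left hA
    rw [← lintegral_indicator_one hAx]
    rfl
  simp_rw [hind]
  -- With the gain fixed first, the admissible positions form a sector of a disc around the
  -- receiver.
  rw [lintegral_lintegral_swap (Measurable.ite hA measurable_const measurable_const).aemeasurable]
  have hinner : ∀ᵐ g ∂ν, ∫⁻ x, (if (x, g) ∈ strongNodes α φ rx t then (1 : ℝ≥0∞) else 0) =
      ENNReal.ofReal φ * ENNReal.ofReal (g ^ (2 / α) * (t ^ (-(2 / α)) / 2)) := by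
    filter_upwards [hpos] with g hg
    let f : ℝ → ℝ≥0∞ := fun r =>
      if ENNReal.ofReal t ≤ ENNReal.ofReal (g * r ^ (-α)) then 1 else 0
    have hf : Measurable f := Measurable.ite (measurableSet_le measurable_const (by fun_prop))
      measurable_const measurable_const
    have h1 : ∀ x, (if (x, g) ∈ strongNodes α φ rx t then (1 : ℝ≥0∞) else 0) =
        (fun y => if polarAngle y ≤ φ then f ‖y‖ else 0) (x - rx) := by
      intro x
      simp only [strongNodes, interferencePower, norm_sub_rev rx x, f, Set.mem_ofPred_eq, ite_and]
    simp_rw [h1]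
    rw [lintegral_sub_right_eq_self (fun y => if polarAngle y ≤ φ then f ‖y‖ else 0) rx,
      lintegral_sector hφ' hf, setLIntegral_ofReal_ite_le hα hg ht]
  have h2α : 2 / α ≤ 1 := (div_le_one (by linarith)).2 hα.le
  have hα0 : 0 < α := by linarith
  have hM := integrable_rpow_of_le_one hpos hint (by positivity : 0 ≤ 2 / α) h2α
  rw [lintegral_congr_ae hinner, lintegral_const_mul _ (by fun_prop),
    ← ofReal_integral_eq_lintegral_ofReal (hM.mul_const _) (hpos.mono fun g hg => by positivity),
    integral_mul_const, ← ENNReal.ofReal_mul hφ.le]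
  congr 1
  rw [gainMoment]
  ring

/-- This replaces order statistics by counts of marked points in fixed sets, to which the marking
theorem applies. -/
lemma dominantInterference_eq_lintegral (x : ℕ → Plane) (g : ℕ → ℝ) (k : ℕ) :
    dominantInterference α φ rx x g k =
      ∫⁻ t in Set.Ioi (0 : ℝ), {t | (k : ℕ∞) ≤
        {i | (x i, g i) ∈ strongNodes α φ rx t}.encard}.indicator 1 t := by
  have hm : MeasurableSet {t | (k : ℕ∞) ≤ {i | (x i, g i) ∈ strongNodes α φ rx t}.encard} :=
    measurableSet_le_encard (fun i => (measurableSet_strongNodes_uncurry α φ rx).preimage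
      (measurable_prodMk_left (x := (x i, g i)))) k
  rw [lintegral_indicator_one hm, Measure.restrict_apply hm, Set.inter_comm, dominantInterference,
    kthLargest_eq_volume]
  rfl

lemma lintegral_dominantInterference (hX : ∀ i, Measurable (X i)) (hh : ∀ i, Measurable (h i))
    (k : ℕ) :
    ∫⁻ ω, dominantInterference α φ rx (fun i => X i ω) (fun i => h i ω) k ∂P =
      ∫⁻ t in Set.Ioi (0 : ℝ),
        P {ω | (k : ℕ∞) ≤ {i | (X i ω, h i ω) ∈ strongNodes α φ rx t}.encard} := by
  have hm : MeasurableSet {p : Ω × ℝ | (k : ℕ∞) ≤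
      {i | (X i p.1, h i p.1) ∈ strongNodes α φ rx p.2}.encard} :=
    measurableSet_le_encard (fun i => (measurableSet_strongNodes_uncurry α φ rx).preimage
      ((((hX i).comp measurable_fst).prodMk ((hh i).comp measurable_fst)).prodMk
        measurable_snd)) k
  simp_rw [dominantInterference_eq_lintegral]
  rw [lintegral_lintegral_swap (f := fun ω t => {t | (k : ℕ∞) ≤
    {i | (X i ω, h i ω) ∈ strongNodes α φ rx t}.encard}.indicator 1 t)
    (Measurable.aemeasurable (measurable_one.indicator hm))]
  refine lintegral_congr fun t => ?_
  have hmt : MeasurableSet {ω | (k : ℕ∞) ≤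
      {i | (X i ω, h i ω) ∈ strongNodes α φ rx t}.encard} := measurable_prodMk_right hm
  rw [← lintegral_indicator_one hmt]
  rfl

lemma measurable_dominantInterference (hX : ∀ i, Measurable (X i)) (hh : ∀ i, Measurable (h i))
    (k : ℕ) :
    Measurable fun ω => dominantInterference α φ rx (fun i => X i ω) (fun i => h i ω) k := by
  have hm : MeasurableSet {p : Ω × ℝ | (k : ℕ∞) ≤
      {i | (X i p.1, h i p.1) ∈ strongNodes α φ rx p.2}.encard} :=
    measurableSet_le_encard (fun i => (measurableSet_strongNodes_uncurry α φ rx).preimage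
      ((((hX i).comp measurable_fst).prodMk ((hh i).comp measurable_fst)).prodMk
        measurable_snd)) k
  simp_rw [dominantInterference_eq_lintegral]
  exact Measurable.lintegral_prod_right' (f := Set.indicator _ 1) (measurable_one.indicator hm)

lemma integral_pos_of_ae_pos {f : ℝ → ℝ} (hf : Integrable f ν) (hpos : ∀ᵐ x ∂ν, 0 < f x) :
    0 < ∫ x, f x ∂ν := by
  refine (integral_nonneg_of_ae (hpos.mono fun _ ht => ht.le)).lt_of_ne fun h0 => ?_
  have h1 := (integral_eq_zero_iff_of_nonneg_ae (hpos.mono fun t ht => ht.le) hf).1 h0.symm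
  obtain ⟨_, ht, ht'⟩ := (hpos.and h1).exists
  exact ht.ne' ht'

lemma gainMoment_pos (hpos : ∀ᵐ t ∂ν, 0 < t) (hint : Integrable (fun t : ℝ => t) ν) {s : ℝ}
    (hs : 0 ≤ s) (hs1 : s ≤ 1) : 0 < gainMoment ν s :=
  integral_pos_of_ae_pos (integrable_rpow_of_le_one hpos hint hs hs1)
    (hpos.mono fun _ ht => Real.rpow_pos_of_pos ht s)

/-- This is `tsum_lintegral_poissonTail` with `β = α / 2`. Writing `n = l + 1` turns `Γ n` into
`l.factorial`. -/
lemma lintegral_partialInterference (hlam : 0 < lam) (hα : 2 < α) (hφ : 0 < φ)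
    (hφ' : φ ≤ 2 * Real.pi) {l : ℕ} (hl : α / 2 < l + 2)
    (hX : IsHomogeneousPoissonProcess P X lam) (hh : IsChannelGain P X h ν)
    (hpos : ∀ᵐ t ∂ν, 0 < t) (hint : Integrable (fun t : ℝ => t) ν) :
    ∫⁻ ω, partialInterference α φ rx (l + 1) (fun i => X i ω) (fun i => h i ω) ∂P =
      ENNReal.ofReal ((lam * (φ * gainMoment ν (2 / α) / 2)) ^ (α / 2) *
        Real.Gamma (l + 2 - α / 2) / ((α / 2 - 1) * l.factorial)) := by
  have hα0 : 0 < α := by linarith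
  have hM : 0 < gainMoment ν (2 / α) := gainMoment_pos hpos hint (by positivity)
    ((div_le_one hα0).2 hα.le)
  have hc : 0 < lam * (φ * gainMoment ν (2 / α) / 2) := by positivity
  unfold partialInterference
  rw [lintegral_tsum fun k => (measurable_dominantInterference hX.measurable hh.measurable
      _).aemeasurable, ← tsum_lintegral_poissonTail l (by linarith) hl hc]
  refine tsum_congr fun k => ?_
  rw [lintegral_dominantInterference hX.measurable hh.measurable]
  refine setLIntegral_congr_fun measurableSet_Ioi fun t ht => ?_
  have ht' : 0 < t := ht
  have hmean := lintegral_measure_strongNodes (rx := rx) hα hφ hφ' hpos hint ht'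
  have hA := measurableSet_strongNodes α φ rx t
  have hnonneg : 0 ≤ φ * gainMoment ν (2 / α) / 2 * t ^ (-(2 / α)) := by positivity
  rw [measure_le_of_poisson (measurable_markedCount hX hh hA)
    (markedCount_poisson hX hh hA (by rw [hmean]; exact ENNReal.ofReal_ne_top)), hmean]
  congr 2
  rw [NNReal.coe_mul, Real.coe_toNNReal _ hlam.le, ENNReal.coe_toNNReal_eq_toReal,
    ENNReal.toReal_ofReal hnonneg, inv_div]
  ring

lemma equivalentRadius_pos (hlam : 0 < lam) (hα : 2 < α) (hφ : 0 < φ) {n : ℕ} (hn : 1 ≤ n)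
    (hnα : α < 2 * ((n : ℝ) + 1)) (hpos : ∀ᵐ t ∂ν, 0 < t)
    (hint : Integrable (fun t : ℝ => t) ν) : 0 < equivalentRadius α φ lam ν n := by
  have hM : 0 < gainMoment ν (2 / α) := gainMoment_pos hpos hint (by positivity)
    ((div_le_one (by linarith)).2 hα.le)
  have hE : 0 < ∫ t, t ∂ν := integral_pos_of_ae_pos hint hpos
  have hn' : (0 : ℝ) < n := by exact_mod_cast hn
  have hΓ : 0 < realPochhammer n (1 - α / 2) :=
    div_pos (Real.Gamma_pos_of_pos (by linarith)) (Real.Gamma_pos_of_pos hn')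
  have hpi := Real.pi_pos
  unfold equivalentRadius
  positivity

lemma equivalentRadius_rpow (hlam : 0 < lam) (hα : 2 < α) (hφ : 0 < φ) {n : ℕ} (hn : 1 ≤ n)
    (hnα : α < 2 * ((n : ℝ) + 1)) (hpos : ∀ᵐ t ∂ν, 0 < t)
    (hint : Integrable (fun t : ℝ => t) ν) :
    equivalentRadius α φ lam ν n ^ (2 - α) =
      (φ * gainMoment ν (2 / α) / 2) ^ (α / 2) *
        (realPochhammer n (1 - α / 2) / (Real.pi * ∫ t, t ∂ν)) * lam ^ (α / 2 - 1) := by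
  have hM : 0 < gainMoment ν (2 / α) := gainMoment_pos hpos hint (by positivity)
    ((div_le_one (by linarith)).2 hα.le)
  have hE : 0 < ∫ t, t ∂ν := integral_pos_of_ae_pos hint hpos
  have hn' : (0 : ℝ) < n := by exact_mod_cast hn
  have hΓ : 0 < realPochhammer n (1 - α / 2) :=
    div_pos (Real.Gamma_pos_of_pos (by linarith)) (Real.Gamma_pos_of_pos hn')
  have hpi := Real.pi_pos
  have h2α : 2 - α ≠ 0 := by linarith
  have hexp : α / (2 * (2 - α)) * (2 - α) = α / 2 := by field_simp
  unfold equivalentRadius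
  rw [Real.mul_rpow (by positivity) (by positivity), Real.mul_rpow (by positivity) (by positivity),
    ← Real.rpow_mul (by positivity), ← Real.rpow_mul (by positivity), ← Real.rpow_mul hlam.le,
    hexp, one_div_mul_cancel h2α, Real.rpow_one]
  congr 2
  ring

end Interference

theorem mainTheorem6 {Ω : Type*} [MeasurableSpace Ω] (P : Measure Ω) [IsProbabilityMeasure P]
    (X : ℕ → Ω → Plane) (h : ℕ → Ω → ℝ) (ν : Measure ℝ) [IsProbabilityMeasure ν]
    (lam α φ : ℝ) (n : ℕ) (rx : Plane)
    (hlam : 0 < lam) (hα : 2 < α) (hφ : 0 < φ) (hφ' : φ ≤ 2 * Real.pi)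
    (hn : 1 ≤ n) (hnα : α < 2 * ((n : ℝ) + 1))
    (hX : IsHomogeneousPoissonProcess P X lam)
    (hh : IsChannelGain P X h ν)
    (hpos : ∀ᵐ t ∂ν, 0 < t) (hint : Integrable (fun t : ℝ => t) ν) :
    (∀ R : ℝ, 0 < R →
      ∫⁻ ω, outsideInterference α rx R (fun i => X i ω) (fun i => h i ω) ∂P =
        ENNReal.ofReal (2 * Real.pi * lam * (∫ t, t ∂ν) * R ^ (2 - α) / (α - 2))) ∧
    0 < equivalentRadius α φ lam ν n ∧
    ∫⁻ ω, partialInterference α φ rx n (fun i => X i ω) (fun i => h i ω) ∂P =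
      ∫⁻ ω, outsideInterference α rx (equivalentRadius α φ lam ν n)
        (fun i => X i ω) (fun i => h i ω) ∂P := by
  have hR := equivalentRadius_pos hlam hα hφ hn hnα hpos hint
  refine ⟨fun R => lintegral_outsideInterference hlam hα hX hh hpos hint, hR, ?_⟩
  rw [lintegral_outsideInterference hlam hα hX hh hpos hint hR,
    equivalentRadius_rpow hlam hα hφ hn hnα hpos hint]
  obtain ⟨l, rfl⟩ : ∃ l, n = l + 1 := ⟨n - 1, by omega⟩
  have hl : α / 2 < l + 2 := by push_cast at hnα; linarith
  rw [lintegral_partialInterference hlam hα hφ hφ' hl hX hh hpos hint]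
  congr 1
  have hM : 0 < gainMoment ν (2 / α) := gainMoment_pos hpos hint (by positivity)
    ((div_le_one (by linarith)).2 hα.le)
  have hE : 0 < ∫ t, t ∂ν := integral_pos_of_ae_pos hint hpos
  have hpi := Real.pi_pos
  have hα2 : α - 2 ≠ 0 := by linarith
  have hα2' : α / 2 - 1 ≠ 0 := by
    intro h0; exact hα2 (by linarith)
  have hfac : (l.factorial : ℝ) ≠ 0 := by positivity
  -- The prefactor `lam` of the outside mean raises `lam ^ (α / 2 - 1)` to `lam ^ (α / 2)`, the
  -- power that comes from `c ^ (α / 2)`.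
  rw [Real.mul_rpow hlam.le (by positivity), Real.rpow_sub_one hlam.ne', realPochhammer]
  push_cast
  rw [Real.Gamma_nat_eq_factorial, show (l : ℝ) + 1 + (1 - α / 2) = l + 2 - α / 2 by ring,
    show α / 2 - 1 = (α - 2) / 2 by ring]
  generalize (φ * gainMoment ν (2 / α) / 2) ^ (α / 2) = A
  generalize lam ^ (α / 2) = B
  field_simp
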